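/- Let $p,q,r,s\in\mathbb N$ with $(p-q)(r-s)\ge 0$. Let $\mathfrak g=\mathfrak{gl}^{p+q|r+s}$ over $\mathbb C$, let $\theta(x)=\sigma x\sigma^{-1}$ with $\sigma=\mathrm{diag}(1_p,-1_q\,|\,1_r,-1_s)$, and let $\mathfrak k=\mathfrak{gl}^{p|r}\times\mathfrak{gl}^{q|s}$ and $\mathfrak p$ be the $(+1)$- and $(-1)$-eigenspaces of $\theta$. An even Cartan subspace is an Abelian subalgebra $\mathfrak a\subseteq\mathfrak p_{\bar 0}$ consisting of semi-simple elements of $\mathfrak g_{\bar 0}$ such that $\mathfrak p=\mathfrak a+[\mathfrak k,\mathfrak a]$. The symmetric superpair $(\mathfrak g,\mathfrak k)$ is of even type, that is, an even Cartan subspace exists. Moreover, for every finite-dimensional irreducible representation $V$ of the Lie superalgebra $\mathfrak g$ (irreducible meaning that $V\ne 0$ and that $0$ and $V$ are the only invariant graded subspaces), the following hold. (1) Let $\mathfrak a$ be an even Cartan subspace, let $\mathfrak h\supseteq\mathfrak a$ be a $\theta$-stable Cartan subalgebra of $\mathfrak g$ contained in $\mathfrak g_{\bar 0}$, and let $\Delta^+$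 be a positive system of the set $\Delta(\mathfrak g:\mathfrak h)$ of roots that is compatible with $\theta$, i.e. $(\Delta^+|_{\mathfrak a})\setminus\{0\}$ is a positive system of the set $\Sigma(\mathfrak g:\mathfrak a)$ of restricted roots. (Here, a positive system of a set $S$ of roots is a subset $P$ such that $S$ is the disjoint union of $P$ and $-P$, and $S\cap(P+P)\subseteq P$.) If $V$ has highest weight $\lambda\in\mathfrak h^*$ with respect to $\Delta^+$ and $\lambda$ vanishes on $\mathfrak h\cap\mathfrak k$, then $V$ is self-dual, i.e. there is an even isomorphism $V\cong V^*$ of $\mathfrak g$-representations, where $\mathfrak g$ acts on $V^*$ by $(x\mu)(v)=-(-1)^{|x||\mu|}\mu(xv)$ for homogeneous $x\in\mathfrak g$, $\mu\in V^*$. (2) If $V$ is spherical, i.e. it contains a non-zero $\mathfrak k$-invariant vector, then $V$ is self-dual. -/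

import Mathlib

/-!
The symmetric superpair `(gl^{p+q|r+s}, gl^{p|r} × gl^{q|s})` over the complex numbers, its even
Cartan subspaces, roots and positive systems, and finite-dimensional representations.
-/

namespace SuperGL

/-! ### The Lie superalgebra `gl^{p+q|r+s}` -/

/-- The index set of the standard basis of `ℂ^{p+q|r+s}`: the left summand is even, the right
summand is odd. -/
abbrev Idx (p q r s : ℕ) : Type := (Fin p ⊕ Fin q) ⊕ (Fin r ⊕ Fin s)

/-- The super-vector space `gl^{p+q|r+s}` of complex matrices of size `p+q|r+s`. -/
abbrev Mat (p q r s : ℕ) : Type := Matrix (Idx p q r s) (Idx p q r s) ℂ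

variable {p q r s : ℕ}

/-- The parity of a standard basis vector. -/
def parity : Idx p q r s → ZMod 2
  | Sum.inl _ => 0
  | Sum.inr _ => 1

/-- The homogeneous part of parity `i` of `gl^{p+q|r+s}`: block diagonal matrices for `i = 0`,
block off-diagonal matrices for `i = 1`. -/
def homog (p q r s : ℕ) (i : ZMod 2) : Submodule ℂ (Mat p q r s) where
  carrier := {x | ∀ a b, parity a + parity b ≠ i → x a b = 0}
  add_mem' := by
    intro x y hx hy a b hab
    simp [hx a b hab, hy a b hab]
  zero_mem' := by
    intro a b _
    rfl
  smul_mem' := by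
    intro c x hx a b hab
    simp [hx a b hab]

/-- The component of parity `i` of a matrix. -/
def part (i : ZMod 2) : Mat p q r s →ₗ[ℂ] Mat p q r s where
  toFun x := Matrix.of fun a b => if parity a + parity b = i then x a b else 0
  map_add' := by
    intro x y
    ext a b
    simp only [Matrix.of_apply, Matrix.add_apply]
    split_ifs <;> simp
  map_smul' := by
    intro c x
    ext a b
    simp only [Matrix.of_apply, Matrix.smul_apply, RingHom.id_apply]
    split_ifs <;> simp

/-- The sign `(-1)^{ij}`. -/
def sgn (i j : ZMod 2) : ℂ := (-1) ^ (i.val * j.val)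

/-- The supercommutator `[x, y] = x y - (-1)^{|x||y|} y x`, extended bilinearly from homogeneous
elements. -/
def sbracket (x y : Mat p q r s) : Mat p q r s :=
  ∑ i : ZMod 2, ∑ j : ZMod 2, (part i x * part j y - sgn i j • (part j y * part i x))

lemma part_mem (i : ZMod 2) (x : Mat p q r s) : part i x ∈ homog p q r s i := by
  intro a b hab
  simp [part, hab]

lemma part_of_mem {i : ZMod 2} {x : Mat p q r s} (hx : x ∈ homog p q r s i) : part i x = x := by
  ext a b
  by_cases h : parity a + parity b = i
  · simp [part, h]
  · simp [part, h, hx a b h]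

lemma part_of_mem_ne {i j : ZMod 2} (hij : j ≠ i) {x : Mat p q r s}
    (hx : x ∈ homog p q r s i) : part j x = 0 := by
  ext a b
  by_cases h : parity a + parity b = j
  · simp [part, h, hx a b (h ▸ hij)]
  · simp [part, h]

lemma part_add_part (x : Mat p q r s) : part 0 x + part 1 x = x := by
  ext a b
  have h : ∀ c : ZMod 2, (c = 0 ∧ c ≠ 1) ∨ (c ≠ 0 ∧ c = 1) := by decide
  rcases h (parity a + parity b) with ⟨h0, h1⟩ | ⟨h0, h1⟩
  · simp [part, h0]
  · simp [part, h1]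

/-- On homogeneous elements, the bracket is the supercommutator. -/
lemma sbracket_of_mem {i j : ZMod 2} {x y : Mat p q r s} (hx : x ∈ homog p q r s i)
    (hy : y ∈ homog p q r s j) : sbracket x y = x * y - sgn i j • (y * x) := by
  unfold sbracket
  rw [Finset.sum_eq_single i, Finset.sum_eq_single j, part_of_mem hx, part_of_mem hy]
  · intro b _ hb
    simp [part_of_mem_ne hb hy]
  · simp
  · intro b _ hb
    simp [part_of_mem_ne hb hx]
  · simp

lemma mul_mem_homog {i j : ZMod 2} {x y : Mat p q r s} (hx : x ∈ homog p q r s i)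
    (hy : y ∈ homog p q r s j) : x * y ∈ homog p q r s (i + j) := by
  intro a b hab
  rw [Matrix.mul_apply]
  refine Finset.sum_eq_zero fun c _ => ?_
  by_cases h : parity a + parity c = i
  · by_cases h' : parity c + parity b = j
    · exfalso
      apply hab
      rw [← h, ← h']
      have : ∀ u v w : ZMod 2, u + v = u + w + (w + v) := by decide
      exact this _ _ _
    · rw [hy c b h', mul_zero]
  · rw [hx a c h, zero_mul]

lemma sbracket_mem {i j : ZMod 2} {x y : Mat p q r s} (hx : x ∈ homog p q r s i)
    (hy : y ∈ homog p q r s j) : sbracket x y ∈ homog p q r s (i + j) := by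
  rw [sbracket_of_mem hx hy]
  refine Submodule.sub_mem _ (mul_mem_homog hx hy) (Submodule.smul_mem _ _ ?_)
  rw [add_comm]
  exact mul_mem_homog hy hx

/-! ### The involution -/

/-- The matrix `σ = diag(1_p, -1_q | 1_r, -1_s)`. -/
def sigma (p q r s : ℕ) : Mat p q r s :=
  Matrix.diagonal (Sum.elim (Sum.elim (fun _ => 1) (fun _ => -1))
    (Sum.elim (fun _ => 1) (fun _ => -1)))

/-- The involution `θ(x) = σ x σ⁻¹`. -/
noncomputable def theta (x : Mat p q r s) : Mat p q r s := sigma p q r s * x * (sigma p q r s)⁻¹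

/-- The subalgebra `𝔨 = gl^{p|r} × gl^{q|s}` of fixed points of `θ`. -/
def kPart (p q r s : ℕ) : Submodule ℂ (Mat p q r s) where
  carrier := {x | theta x = x}
  add_mem' := by
    intro x y hx hy
    simp only [Set.mem_ofPred_eq, theta] at *
    rw [Matrix.mul_add, Matrix.add_mul, hx, hy]
  zero_mem' := by simp [theta]
  smul_mem' := by
    intro c x hx
    simp only [Set.mem_ofPred_eq, theta] at *
    rw [Matrix.mul_smul, Matrix.smul_mul, hx]

/-- The `(-1)`-eigenspace `𝔭` of `θ`. -/
def pPart (p q r s : ℕ) : Submodule ℂ (Mat p q r s) where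
  carrier := {x | theta x = -x}
  add_mem' := by
    intro x y hx hy
    simp only [Set.mem_ofPred_eq, theta] at *
    rw [Matrix.mul_add, Matrix.add_mul, hx, hy, neg_add]
  zero_mem' := by simp [theta]
  smul_mem' := by
    intro c x hx
    simp only [Set.mem_ofPred_eq, theta] at *
    rw [Matrix.mul_smul, Matrix.smul_mul, hx, smul_neg]

/-! ### Even Cartan subspaces, Cartan subalgebras, roots -/

/-- A toral subspace of `𝔤_0̄`: an Abelian subalgebra that consists of semi-simple elements. -/
def IsToral (t : Submodule ℂ (Mat p q r s)) : Prop :=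
  t ≤ homog p q r s 0 ∧ (∀ x ∈ t, ∀ y ∈ t, sbracket x y = 0) ∧
    ∀ x ∈ t, Module.End.IsSemisimple (Matrix.toLin' x)

/-- An even Cartan subspace: an Abelian subalgebra `𝔞 ⊆ 𝔭_0̄` of semi-simple elements of `𝔤_0̄`
such that `𝔭 = 𝔞 + [𝔨, 𝔞]`. -/
def IsEvenCartanSubspace (a : Submodule ℂ (Mat p q r s)) : Prop :=
  a ≤ pPart p q r s ∧ IsToral a ∧
    a ⊔ Submodule.span ℂ {z | ∃ x ∈ kPart p q r s, ∃ y ∈ a, z = sbracket x y} = pPart p q r s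

/-- The symmetric superpair `(gl^{p+q|r+s}, gl^{p|r} × gl^{q|s})` is of even type. -/
def IsEvenType (p q r s : ℕ) : Prop :=
  ∃ a : Submodule ℂ (Mat p q r s), IsEvenCartanSubspace a

/-- A Cartan subalgebra of `gl^{p+q|r+s}`, that is, of its reductive even part `𝔤_0̄`: a maximal
Abelian subalgebra of `𝔤_0̄` that consists of semi-simple elements. -/
def IsCartan (h : Submodule ℂ (Mat p q r s)) : Prop :=
  IsToral h ∧ ∀ h' : Submodule ℂ (Mat p q r s), IsToral h' → h ≤ h' → h' = h

/-- The simultaneous eigenspace for the adjoint action of `t` and the linear form `α` on `t`. -/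
def rootSpace (t : Submodule ℂ (Mat p q r s)) (α : Module.Dual ℂ t) : Set (Mat p q r s) :=
  {x | ∀ u : t, sbracket (u : Mat p q r s) x = α u • x}

/-- The roots of `gl^{p+q|r+s}` with respect to `t`. For a Cartan subalgebra these are the roots
`Δ(𝔤 : 𝔥)`, and for an even Cartan subspace the restricted roots `Σ(𝔤 : 𝔞)`. -/
def roots (t : Submodule ℂ (Mat p q r s)) : Set (Module.Dual ℂ t) :=
  {α | α ≠ 0 ∧ ∃ x ∈ rootSpace t α, x ≠ 0}

/-- `P` is a positive system of `S`: `S` is the disjoint union of `P` and `-P`, and sums of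
elements of `P` which lie in `S` lie in `P`. -/
def IsPositiveSystem {E : Type*} [AddCommGroup E] (S P : Set E) : Prop :=
  (∀ α, α ∈ S ↔ α ∈ P ∨ -α ∈ P) ∧ (∀ α ∈ P, -α ∉ P) ∧
    ∀ α ∈ P, ∀ β ∈ P, α + β ∈ S → α + β ∈ P

/-- The restriction of linear forms from `h` to `a`. -/
def restrict {a h : Submodule ℂ (Mat p q r s)} (hah : a ≤ h) (α : Module.Dual ℂ h) :
    Module.Dual ℂ a :=
  α ∘ₗ Submodule.inclusion hah

/-- A positive system `P` of `Δ(𝔤 : 𝔥)` is compatible with `θ` if the non-zero restrictions of its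
elements to `𝔞` form a positive system of `Σ(𝔤 : 𝔞)`. -/
def IsCompatible {a h : Submodule ℂ (Mat p q r s)} (hah : a ≤ h) (P : Set (Module.Dual ℂ h)) :
    Prop :=
  IsPositiveSystem (roots a) (restrict hah '' P \ {0})

/-! ### Representations -/

/-- A representation of the Lie superalgebra `gl^{p+q|r+s}` on a complex super-vector space
`V = V_0̄ ⊕ V_1̄`. -/
structure Rep (p q r s : ℕ) (V : Type*) [AddCommGroup V] [Module ℂ V] where
  /-- the homogeneous parts of `V` -/
  gr : ZMod 2 → Submodule ℂ V
  isCompl : IsCompl (gr 0) (gr 1)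
  /-- the action -/
  act : Mat p q r s →ₗ[ℂ] Module.End ℂ V
  act_mem : ∀ i j, ∀ x ∈ homog p q r s i, ∀ v ∈ gr j, act x v ∈ gr (i + j)
  act_sbracket : ∀ i j, ∀ x ∈ homog p q r s i, ∀ y ∈ homog p q r s j,
    act (sbracket x y) = act x * act y - sgn i j • (act y * act x)

namespace Rep

variable {V : Type*} [AddCommGroup V] [Module ℂ V] {W : Type*} [AddCommGroup W] [Module ℂ W]

/-- Irreducibility: `V ≠ 0`, and the only invariant graded subspaces are `0` and `V`. -/
def IsIrreducible (ρ : Rep p q r s V) : Prop :=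
  Nontrivial V ∧ ∀ U : Submodule ℂ V, U = (U ⊓ ρ.gr 0) ⊔ (U ⊓ ρ.gr 1) →
    (∀ x, ∀ v ∈ U, ρ.act x v ∈ U) → U = ⊥ ∨ U = ⊤

/-- `lam` is a highest weight of the representation with respect to the Cartan subalgebra `h` and
the positive system `P`: there is a non-zero weight vector of weight `lam` that is annihilated by
all positive root spaces. (In an irreducible representation it is automatically cyclic.) -/
def HasHighestWeight (ρ : Rep p q r s V) (h : Submodule ℂ (Mat p q r s))
    (P : Set (Module.Dual ℂ h)) (lam : Module.Dual ℂ h) : Prop :=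
  ∃ v : V, v ≠ 0 ∧ (∀ u : h, ρ.act (u : Mat p q r s) v = lam u • v) ∧
    ∀ β ∈ P, ∀ x ∈ rootSpace h β, ρ.act x v = 0

/-- Sphericity: there is a non-zero vector invariant under `𝔨 = gl^{p|r} × gl^{q|s}`. -/
def IsSpherical (ρ : Rep p q r s V) : Prop :=
  ∃ v : V, v ≠ 0 ∧ ∀ x ∈ kPart p q r s, ρ.act x v = 0

/-- Isomorphism of representations: an even linear isomorphism that intertwines the actions. -/
def IsIsomorphic (ρ : Rep p q r s V) (τ : Rep p q r s W) : Prop :=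
  ∃ f : V ≃ₗ[ℂ] W, (∀ i, ∀ v ∈ ρ.gr i, f v ∈ τ.gr i) ∧ ∀ x v, f (ρ.act x v) = τ.act x (f v)

/-- The parity operator, equal to `1` on `V_0̄` and to `-1` on `V_1̄`. -/
noncomputable def parityOp (ρ : Rep p q r s V) : Module.End ℂ V :=
  Submodule.projection _ _ ρ.isCompl - Submodule.projection _ _ ρ.isCompl.symm

lemma parityOp_of_mem (ρ : Rep p q r s V) {i : ZMod 2} {v : V} (hv : v ∈ ρ.gr i) :
    ρ.parityOp v = sgn i i • v := by
  have h : ∀ c : ZMod 2, c = 0 ∨ c = 1 := by decide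
  rcases h i with rfl | rfl
  · rw [parityOp, LinearMap.sub_apply, Submodule.projection_apply_of_mem_left _ hv,
      Submodule.projection_apply_of_mem_right _ hv]
    simp [sgn]
  · rw [parityOp, LinearMap.sub_apply, Submodule.projection_apply_of_mem_left _ hv,
      Submodule.projection_apply_of_mem_right _ hv]
    simp [sgn, ZMod.val_one]

lemma exists_add (ρ : Rep p q r s V) (v : V) : ∃ a ∈ ρ.gr 0, ∃ b ∈ ρ.gr 1, a + b = v :=
  Submodule.mem_sup.1 (ρ.isCompl.sup_eq_top ▸ Submodule.mem_top)

lemma parityOp_act (ρ : Rep p q r s V) {i : ZMod 2} {x : Mat p q r s}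
    (hx : x ∈ homog p q r s i) (v : V) :
    ρ.parityOp (ρ.act x v) = sgn i i • ρ.act x (ρ.parityOp v) := by
  have key : ∀ j, ∀ w ∈ ρ.gr j,
      ρ.parityOp (ρ.act x w) = sgn i i • ρ.act x (ρ.parityOp w) := by
    intro j w hw
    rw [ρ.parityOp_of_mem (ρ.act_mem i j x hx w hw), ρ.parityOp_of_mem hw, map_smul, smul_smul]
    congr 1
    have h : ∀ c : ZMod 2, c = 0 ∨ c = 1 := by decide
    have h11 : (1 + 1 : ZMod 2) = 0 := by decide
    rcases h i with rfl | rfl <;> rcases h j with rfl | rfl <;> simp [sgn, ZMod.val_one, h11]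
  obtain ⟨a, ha, b, hb, rfl⟩ := ρ.exists_add v
  simp only [map_add, smul_add, key 0 a ha, key 1 b hb]

lemma parityOp_parityOp (ρ : Rep p q r s V) (v : V) : ρ.parityOp (ρ.parityOp v) = v := by
  obtain ⟨a, ha, b, hb, rfl⟩ := ρ.exists_add v
  simp [ρ.parityOp_of_mem ha, ρ.parityOp_of_mem hb, sgn, ZMod.val_one]

/-- The homogeneous part of parity `i` of the dual space: the linear forms that vanish on the
part of `V` of the other parity. -/
def dualGr (ρ : Rep p q r s V) (i : ZMod 2) : Submodule ℂ (Module.Dual ℂ V) :=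
  (ρ.gr (i + 1)).dualAnnihilator

/-- The dual action `(x μ)(v) = -(-1)^{|x||μ|} μ(x v)`, written with the parity operator; see
`dualAct_apply`. -/
noncomputable def dualAct (ρ : Rep p q r s V) :
    Mat p q r s →ₗ[ℂ] Module.End ℂ (Module.Dual ℂ V) where
  toFun x := -(Module.Dual.transpose (ρ.act (part 0 x)) +
    Module.Dual.transpose (ρ.parityOp * ρ.act (part 1 x)))
  map_add' := by
    intro x y
    simp only [map_add, mul_add]
    abel
  map_smul' := by
    intro c x
    simp only [map_smul, mul_smul_comm, RingHom.id_apply, smul_neg, smul_add]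

lemma dualAct_even (ρ : Rep p q r s V) {x : Mat p q r s} (hx : x ∈ homog p q r s 0)
    (μ : Module.Dual ℂ V) (v : V) : ρ.dualAct x μ v = -μ (ρ.act x v) := by
  simp [dualAct, part_of_mem hx, part_of_mem_ne one_ne_zero hx, Module.Dual.transpose_apply]

lemma dualAct_odd (ρ : Rep p q r s V) {x : Mat p q r s} (hx : x ∈ homog p q r s 1)
    (μ : Module.Dual ℂ V) (v : V) : ρ.dualAct x μ v = -μ (ρ.parityOp (ρ.act x v)) := by
  simp [dualAct, part_of_mem hx, part_of_mem_ne zero_ne_one hx, Module.Dual.transpose_apply]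

lemma apply_parityOp (ρ : Rep p q r s V) {j : ZMod 2} {μ : Module.Dual ℂ V}
    (hμ : μ ∈ ρ.dualGr j) (v : V) : μ (ρ.parityOp v) = sgn j j * μ v := by
  obtain ⟨a, ha, b, hb, rfl⟩ := ρ.exists_add v
  rw [dualGr, Submodule.mem_dualAnnihilator] at hμ
  have h : ∀ c : ZMod 2, c = 0 ∨ c = 1 := by decide
  have h11 : (1 + 1 : ZMod 2) = 0 := by decide
  rcases h j with rfl | rfl
  · simp [ρ.parityOp_of_mem ha, ρ.parityOp_of_mem hb, sgn, ZMod.val_one, hμ b (by simpa using hb)]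
  · simp [ρ.parityOp_of_mem ha, ρ.parityOp_of_mem hb, sgn, ZMod.val_one,
      hμ a (by simpa [h11] using ha)]

/-- On homogeneous elements, the dual action is `(x μ)(v) = -(-1)^{|x||μ|} μ(x v)`. -/
lemma dualAct_apply (ρ : Rep p q r s V) {i j : ZMod 2} {x : Mat p q r s}
    (hx : x ∈ homog p q r s i) {μ : Module.Dual ℂ V} (hμ : μ ∈ ρ.dualGr j) (v : V) :
    ρ.dualAct x μ v = -(sgn i j * μ (ρ.act x v)) := by
  have h : ∀ c : ZMod 2, c = 0 ∨ c = 1 := by decide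
  rcases h i with rfl | rfl
  · rw [ρ.dualAct_even hx]
    simp [sgn]
  · rw [ρ.dualAct_odd hx, ρ.apply_parityOp hμ]
    rcases h j with rfl | rfl <;> simp [sgn, ZMod.val_one]

/-- The dual representation on `V^*`. -/
noncomputable def dual (ρ : Rep p q r s V) : Rep p q r s (Module.Dual ℂ V) where
  gr := ρ.dualGr
  isCompl := by
    have h := (Subspace.isCompl_dualAnnihilator ρ.isCompl).symm
    have h11 : (1 + 1 : ZMod 2) = 0 := by decide
    simpa [dualGr, h11] using h
  act := ρ.dualAct
  act_mem := by
    intro i j x hx μ hμ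
    rw [dualGr, Submodule.mem_dualAnnihilator]
    intro v hv
    rw [ρ.dualAct_apply hx hμ]
    rw [dualGr, Submodule.mem_dualAnnihilator] at hμ
    have e : ∀ i j : ZMod 2, i + (i + j + 1) = j + 1 := by decide
    rw [hμ _ (e i j ▸ ρ.act_mem i (i + j + 1) x hx v hv), mul_zero, neg_zero]
  act_sbracket := by
    intro i j x hx y hy
    have hb := sbracket_mem hx hy
    have h : ∀ c : ZMod 2, c = 0 ∨ c = 1 := by decide
    have h11 : (1 + 1 : ZMod 2) = 0 := by decide
    ext μ v
    rcases h i with rfl | rfl <;> rcases h j with rfl | rfl <;>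
      simp only [add_zero, zero_add, h11] at hb
    · simp only [LinearMap.sub_apply, LinearMap.smul_apply, Module.End.mul_apply,
        ρ.dualAct_even hb, ρ.dualAct_even hx, ρ.dualAct_even hy,
        ρ.act_sbracket _ _ x hx y hy, ρ.parityOp_act hx, ρ.parityOp_act hy, ρ.parityOp_parityOp,
        map_sub, map_smul]
      simp [sgn, ZMod.val_one]
    · simp only [LinearMap.sub_apply, LinearMap.smul_apply, Module.End.mul_apply,
        ρ.dualAct_odd hb, ρ.dualAct_even hx, ρ.dualAct_odd hy,
        ρ.act_sbracket _ _ x hx y hy, ρ.parityOp_act hx, ρ.parityOp_act hy, ρ.parityOp_parityOp,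
        map_sub, map_smul]
      simp [sgn, ZMod.val_one]
    · simp only [LinearMap.sub_apply, LinearMap.smul_apply, Module.End.mul_apply,
        ρ.dualAct_odd hb, ρ.dualAct_odd hx, ρ.dualAct_even hy,
        ρ.act_sbracket _ _ x hx y hy, ρ.parityOp_act hx, ρ.parityOp_act hy, ρ.parityOp_parityOp,
        map_sub, map_smul]
      simp [sgn, ZMod.val_one]
    · simp only [LinearMap.sub_apply, LinearMap.smul_apply, Module.End.mul_apply,
        ρ.dualAct_even hb, ρ.dualAct_odd hx, ρ.dualAct_odd hy,
        ρ.act_sbracket _ _ x hx y hy, ρ.parityOp_act hx, ρ.parityOp_act hy, ρ.parityOp_parityOp,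
        map_sub, map_smul]
      simp [sgn, ZMod.val_one]
      ring

/-- Self-duality: `V` and `V^*` are isomorphic as representations of `gl^{p+q|r+s}`. -/
def IsSelfDual (ρ : Rep p q r s V) : Prop :=
  ρ.IsIsomorphic ρ.dual

end Rep

end SuperGL

namespace SuperGL

variable {p q r s : ℕ}

/-! ### Elementary facts on matrices and the bracket -/

/-! Choose a homogeneous basis, the columns of an even invertible `g`, in which the Cartan
subalgebra is diagonal and `σ` is monomial over an involution `π` of the indices (`IsAdapted`). A
positive system becomes an injective height `d` on indices, and compatibility with `θ` says that `π`
reverses the order of `i` and `j` unless both are fixed by `π`. A weight `L` vanishes on `𝔥 ∩ 𝔨`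
exactly when `L i + L (π i) = 0`.

Self-duality: `θ` is inner, so an invertible operator `S` on `V` satisfies `S x = θ(x) S`
(`exists_theta_operator`). If `v` is a highest weight vector of weight `L`, then `S v` has weight
`-L` and is highest for the twisted order `d ∘ π`. Since `L` is zero on fixed indices, the root
vectors between fixed indices kill `S v` in both directions, so `S v` is a lowest weight vector for
`d` (`IsHighest.isLowest`). The form `μ` dual to `v` is a lowest weight vector of `V^*`, of the same
weight and parity. The submodule of `V × V^*` generated by `(S v, μ)` is then the graph of an
isomorphism (`isSelfDual_of_isHighest`).

For (1), a toral subspace is diagonalized blockwise, maximality and `θ`-stability produce the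
adapted basis, and the positive system is a linear order. For (2), a standard adapted basis and
order exist, and a Cartan–Helgason argument gives `L i + L (π i) = 0`: by an Iwasawa-type
decomposition, `𝔤` is `𝔨` plus the opposite Borel subalgebra, so `μ` cannot vanish on the
`𝔨`-invariant vector (`weight_add_eq_zero`). That decomposition needs `σ` to have a single sign on
the fixed indices, which is what `(p-q)(r-s) ≥ 0` provides. The anti-invariant diagonal matrices in
the same basis give the even Cartan subspace. -/

lemma zmod_two_cases (c : ZMod 2) : c = 0 ∨ c = 1 := by
  revert c
  decide

/-- The matrix units. -/
def matUnit (i j : Idx p q r s) : Mat p q r s := Matrix.single i j 1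

lemma matUnit_apply (i j a b : Idx p q r s) :
    matUnit i j a b = if i = a ∧ j = b then 1 else 0 := by
  simp [matUnit, Matrix.single_apply]

lemma matUnit_mem (i j : Idx p q r s) :
    matUnit i j ∈ homog p q r s (parity i + parity j) := by
  intro a b hab
  rw [matUnit_apply, if_neg]
  rintro ⟨rfl, rfl⟩
  exact hab rfl

lemma matUnit_mul (i j k l : Idx p q r s) :
    matUnit i j * matUnit k l = if j = k then matUnit i l else 0 := by
  split_ifs with h
  · subst h
    simp [matUnit]
  · simp [matUnit, h]

lemma eq_sum_matUnit (x : Mat p q r s) : x = ∑ i, ∑ j, x i j • matUnit i j := by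
  conv_lhs => rw [Matrix.matrix_eq_sum_single x]
  simp [matUnit, Matrix.smul_single]

lemma span_eq_top_of_matUnit_mem (S : Submodule ℂ (Mat p q r s)) (h : ∀ i j, matUnit i j ∈ S) :
    S = ⊤ := by
  refine eq_top_iff.2 fun x _ => ?_
  rw [eq_sum_matUnit x]
  exact S.sum_mem fun i _ => S.sum_mem fun j _ => S.smul_mem _ (h i j)

lemma diagonal_eq_sum (u : Idx p q r s → ℂ) :
    (Matrix.diagonal u : Mat p q r s) = ∑ i, u i • matUnit i i := by
  ext a b
  simp only [Matrix.sum_apply, Matrix.smul_apply, matUnit_apply, Matrix.diagonal_apply,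
    smul_eq_mul]
  split_ifs with h
  · subst h
    rw [Finset.sum_eq_single a] <;> simp +contextual
  · refine (Finset.sum_eq_zero fun i _ => ?_).symm
    rw [if_neg, mul_zero]
    rintro ⟨rfl, rfl⟩
    exact h rfl

lemma diagonal_mem (u : Idx p q r s → ℂ) : (Matrix.diagonal u : Mat p q r s) ∈ homog p q r s 0 := by
  intro a b hab
  rw [Matrix.diagonal_apply, if_neg]
  rintro rfl
  have h : ∀ c : ZMod 2, c + c = 0 := by decide
  exact hab (h _)

/-- All signs are trivial as soon as one argument is even, so the other need not be homogeneous. -/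
lemma sbracket_even_left {x : Mat p q r s} (hx : x ∈ homog p q r s 0) (y : Mat p q r s) :
    sbracket x y = x * y - y * x := by
  have e : ∀ f : ZMod 2 → Mat p q r s, ∑ i, f i = f 0 + f 1 := Fin.sum_univ_two
  simp only [sbracket, e, part_of_mem hx, part_of_mem_ne one_ne_zero hx]
  conv_rhs => rw [← part_add_part y]
  simp [sgn, mul_add, add_mul]
  abel

lemma sbracket_even_right {y : Mat p q r s} (hy : y ∈ homog p q r s 0) (x : Mat p q r s) :
    sbracket x y = x * y - y * x := by
  have e : ∀ f : ZMod 2 → Mat p q r s, ∑ i, f i = f 0 + f 1 := Fin.sum_univ_two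
  simp only [sbracket, e, part_of_mem hy, part_of_mem_ne one_ne_zero hy]
  conv_rhs => rw [← part_add_part x]
  simp [sgn, mul_add, add_mul]
  abel

lemma sgn_self_mul_self (i : ZMod 2) : sgn i i * sgn i i = 1 := by
  rcases zmod_two_cases i with rfl | rfl <;> simp [sgn, ZMod.val_one]

lemma sgn_self_ne_zero (i : ZMod 2) : sgn i i ≠ 0 := fun h => by
  simpa [h] using sgn_self_mul_self i

namespace Rep

variable {V : Type*} [AddCommGroup V] [Module ℂ V] {W : Type*} [AddCommGroup W] [Module ℂ W]

/-! ### Products and generation -/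

lemma act_act (ρ : Rep p q r s V) {i j : ZMod 2} {x y : Mat p q r s} (hx : x ∈ homog p q r s i)
    (hy : y ∈ homog p q r s j) (v : V) :
    ρ.act x (ρ.act y v) = ρ.act (sbracket x y) v + sgn i j • ρ.act y (ρ.act x v) := by
  rw [ρ.act_sbracket i j x hx y hy]
  simp

/-- The product (that is, the direct sum) of two representations. -/
def prod (ρ : Rep p q r s V) (τ : Rep p q r s W) : Rep p q r s (V × W) where
  gr i := (ρ.gr i).prod (τ.gr i)
  isCompl := by
    constructor
    · rw [disjoint_iff, Submodule.prod_inf_prod, ρ.isCompl.inf_eq_bot, τ.isCompl.inf_eq_bot,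
        Submodule.prod_bot]
    · rw [codisjoint_iff, Submodule.prod_sup_prod, ρ.isCompl.sup_eq_top, τ.isCompl.sup_eq_top,
        Submodule.prod_top]
  act :=
    { toFun := fun x => (ρ.act x).prodMap (τ.act x)
      map_add' := by
        intro x y
        ext <;> simp
      map_smul' := by
        intro c x
        ext <;> simp }
  act_mem i j x hx v hv := ⟨ρ.act_mem i j x hx _ hv.1, τ.act_mem i j x hx _ hv.2⟩
  act_sbracket i j x hx y hy := by
    ext <;> simp [ρ.act_sbracket i j x hx y hy, τ.act_sbracket i j x hx y hy]

@[simp]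
lemma prod_act (ρ : Rep p q r s V) (τ : Rep p q r s W) (x : Mat p q r s) (w : V × W) :
    (ρ.prod τ).act x w = (ρ.act x w.1, τ.act x w.2) := rfl

@[simp]
lemma prod_parityOp (ρ : Rep p q r s V) (τ : Rep p q r s W) (w : V × W) :
    (ρ.prod τ).parityOp w = (ρ.parityOp w.1, τ.parityOp w.2) := by
  have key : ∀ i, ∀ w ∈ (ρ.prod τ).gr i,
      (ρ.prod τ).parityOp w = (ρ.parityOp w.1, τ.parityOp w.2) := by
    intro i w hw
    rw [parityOp_of_mem _ hw, ρ.parityOp_of_mem hw.1, τ.parityOp_of_mem hw.2]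
    rfl
  obtain ⟨a, ha, b, hb, rfl⟩ := (ρ.prod τ).exists_add w
  rw [map_add, key 0 a ha, key 1 b hb]
  simp

lemma dual_parityOp (ρ : Rep p q r s V) (μ : Module.Dual ℂ V) (v : V) :
    ρ.dual.parityOp μ v = μ (ρ.parityOp v) := by
  obtain ⟨a, ha, b, hb, rfl⟩ := ρ.dual.exists_add μ
  rw [map_add, parityOp_of_mem _ ha, parityOp_of_mem _ hb, LinearMap.add_apply,
    LinearMap.add_apply, ρ.apply_parityOp ha, ρ.apply_parityOp hb]
  simp

/-- Together with `parityOp_of_mem`, this encodes the grading in a single operator, so a map is even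
once it commutes with the parity operators. -/
lemma mem_gr_of_parityOp (ρ : Rep p q r s V) {i : ZMod 2} {v : V}
    (h : ρ.parityOp v = sgn i i • v) : v ∈ ρ.gr i := by
  obtain ⟨a, ha, b, hb, rfl⟩ := ρ.exists_add v
  rw [map_add, ρ.parityOp_of_mem ha, ρ.parityOp_of_mem hb] at h
  rcases zmod_two_cases i with rfl | rfl
  · simp only [sgn, ZMod.val_zero, mul_zero, pow_zero, one_smul, ZMod.val_one, mul_one, pow_one,
      neg_smul] at h
    have hb0 : b = 0 := by
      have h2 : (2 : ℂ) • b = 0 := by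
        rw [two_smul]
        nth_rewrite 1 [← add_left_cancel h]
        simp
      simpa using h2
    simpa [hb0] using ha
  · simp only [sgn, ZMod.val_zero, mul_zero, pow_zero, one_smul, ZMod.val_one, mul_one, pow_one,
      neg_smul, neg_add] at h
    have ha0 : a = 0 := by
      have h2 : (2 : ℂ) • a = 0 := by
        rw [two_smul]
        nth_rewrite 1 [add_right_cancel h]
        simp
      simpa using h2
    simpa [ha0] using hb

/-- Irreducibility in terms of the parity operator. -/
lemma IsIrreducible.eq_bot_or_eq_top {ρ : Rep p q r s V} (hρ : ρ.IsIrreducible)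
    (U : Submodule ℂ V) (hP : ∀ v ∈ U, ρ.parityOp v ∈ U) (hU : ∀ x, ∀ v ∈ U, ρ.act x v ∈ U) :
    U = ⊥ ∨ U = ⊤ := by
  refine hρ.2 U (le_antisymm ?_ (sup_le inf_le_left inf_le_left)) hU
  intro v hv
  obtain ⟨a, ha, b, hb, rfl⟩ := ρ.exists_add v
  have h := hP _ hv
  rw [map_add, ρ.parityOp_of_mem ha, ρ.parityOp_of_mem hb] at h
  simp only [sgn, ZMod.val_zero, mul_zero, pow_zero, one_smul, ZMod.val_one, mul_one, pow_one,
    neg_smul] at h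
  refine Submodule.add_mem_sup ⟨?_, ha⟩ ⟨?_, hb⟩
  · have := U.smul_mem (2⁻¹ : ℂ) (U.add_mem hv h)
    have e : (2⁻¹ : ℂ) • (a + b + (a + -b)) = a := by module
    rwa [e] at this
  · have := U.smul_mem (2⁻¹ : ℂ) (U.sub_mem hv h)
    have e : (2⁻¹ : ℂ) • (a + b - (a + -b)) = b := by module
    rwa [e] at this

/-- The smallest subspace that contains `v` and is stable under the action of `B`. -/
def hull (ρ : Rep p q r s V) (B : Set (Mat p q r s)) (v : V) : Submodule ℂ V :=
  sInf {U | v ∈ U ∧ ∀ b ∈ B, ∀ u ∈ U, ρ.act b u ∈ U}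

lemma mem_hull (ρ : Rep p q r s V) (B : Set (Mat p q r s)) (v : V) : v ∈ ρ.hull B v := by
  simp only [hull, Submodule.mem_sInf]
  exact fun U hU => hU.1

lemma act_mem_hull (ρ : Rep p q r s V) {B : Set (Mat p q r s)} {v : V} {b : Mat p q r s}
    (hb : b ∈ B) {u : V} (hu : u ∈ ρ.hull B v) : ρ.act b u ∈ ρ.hull B v := by
  simp only [hull, Submodule.mem_sInf] at *
  exact fun U hU => hU.2 b hb u (hu U hU)

lemma hull_le (ρ : Rep p q r s V) {B : Set (Mat p q r s)} {v : V} {U : Submodule ℂ V}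
    (hv : v ∈ U) (hU : ∀ b ∈ B, ∀ u ∈ U, ρ.act b u ∈ U) : ρ.hull B v ≤ U :=
  sInf_le ⟨hv, hU⟩

/-- The hull of `v` under `B` is a subrepresentation if `𝔤 = A + B` and `v` is an eigenvector
of `A`. -/
lemma act_mem_hull_of_span (ρ : Rep p q r s V) {A B : Set (Mat p q r s)}
    (hA : ∀ x ∈ A, ∃ i, x ∈ homog p q r s i) (hB : ∀ x ∈ B, ∃ i, x ∈ homog p q r s i)
    (hAB : Submodule.span ℂ (A ∪ B) = ⊤) {v : V} (hv : ∀ x ∈ A, ∃ c : ℂ, ρ.act x v = c • v)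
    (x : Mat p q r s) {w : V} (hw : w ∈ ρ.hull B v) : ρ.act x w ∈ ρ.hull B v := by
  set N := ρ.hull B v with hN
  have reduce : ∀ w, (∀ y ∈ A ∪ B, ρ.act y w ∈ N) → ∀ x, ρ.act x w ∈ N := by
    intro w hw x
    have hx : x ∈ Submodule.span ℂ (A ∪ B) := hAB ▸ Submodule.mem_top
    induction hx using Submodule.span_induction with
    | mem y hy => exact hw y hy
    | zero => simp
    | add y z _ _ h1 h2 => simpa using N.add_mem h1 h2
    | smul c y _ h1 => simpa using N.smul_mem c h1
  -- Stability of `N` under `A` is the issue. The vectors of `N` all of whose images stay in `N`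
  -- include `v` and are stable under `B`: moving `y ∈ A` past `b ∈ B` costs only a bracket, whose
  -- action on `u` is already controlled.
  let U : Submodule ℂ V :=
    { carrier := {w | w ∈ N ∧ ∀ x, ρ.act x w ∈ N}
      add_mem' := fun {a b} ha hb => ⟨N.add_mem ha.1 hb.1, fun x => by
        simpa using N.add_mem (ha.2 x) (hb.2 x)⟩
      zero_mem' := ⟨N.zero_mem, fun x => by simp⟩
      smul_mem' := fun c a ha => ⟨N.smul_mem c ha.1, fun x => by
        simpa using N.smul_mem c (ha.2 x)⟩ }
  have hNU : N ≤ U := by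
    refine ρ.hull_le ⟨ρ.mem_hull B v, reduce v ?_⟩ ?_
    · rintro y (hy | hy)
      · obtain ⟨c, hc⟩ := hv y hy
        rw [hc]
        exact N.smul_mem c (ρ.mem_hull B v)
      · exact ρ.act_mem_hull hy (ρ.mem_hull B v)
    · rintro b hb u ⟨hu, hxu⟩
      refine ⟨hxu b, reduce _ ?_⟩
      obtain ⟨j, hj⟩ := hB b hb
      rintro y (hy | hy)
      · obtain ⟨i, hi⟩ := hA y hy
        rw [ρ.act_act hi hj]
        exact N.add_mem (hxu _) (N.smul_mem _ (ρ.act_mem_hull hb (hxu y)))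
      · exact ρ.act_mem_hull hy (hxu b)
  exact (hNU hw).2 x

lemma parityOp_mem_hull (ρ : Rep p q r s V) {B : Set (Mat p q r s)}
    (hB : ∀ x ∈ B, ∃ i, x ∈ homog p q r s i) {v : V} {ε : ℂ} (hv : ρ.parityOp v = ε • v)
    {w : V} (hw : w ∈ ρ.hull B v) : ρ.parityOp w ∈ ρ.hull B v := by
  set N := ρ.hull B v with hN
  have h : N ≤ N ⊓ N.comap ρ.parityOp := by
    refine ρ.hull_le ⟨ρ.mem_hull B v, ?_⟩ ?_
    · rw [SetLike.mem_coe, Submodule.mem_comap, hv]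
      exact N.smul_mem ε (ρ.mem_hull B v)
    · rintro b hb u ⟨hu, hu'⟩
      refine ⟨ρ.act_mem_hull hb hu, ?_⟩
      obtain ⟨i, hi⟩ := hB b hb
      rw [SetLike.mem_coe, Submodule.mem_comap, ρ.parityOp_act hi]
      exact N.smul_mem _ (ρ.act_mem_hull hb hu')
  exact (h hw).2

/-- A substitute for the Poincaré–Birkhoff–Witt theorem: when `A` acts on `v` by scalars, `B` alone
generates the module. It serves both for the triangular decomposition and for `𝔨` plus a Borel
subalgebra. -/
lemma IsIrreducible.eq_top_of_stable {ρ : Rep p q r s V} (hρ : ρ.IsIrreducible)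
    {A B : Set (Mat p q r s)} (hA : ∀ x ∈ A, ∃ i, x ∈ homog p q r s i)
    (hB : ∀ x ∈ B, ∃ i, x ∈ homog p q r s i) (hAB : Submodule.span ℂ (A ∪ B) = ⊤) {v : V}
    (hv0 : v ≠ 0) {ε : ℂ} (hε : ρ.parityOp v = ε • v)
    (hv : ∀ x ∈ A, ∃ c : ℂ, ρ.act x v = c • v) {U : Submodule ℂ V} (hvU : v ∈ U)
    (hU : ∀ b ∈ B, ∀ u ∈ U, ρ.act b u ∈ U) : U = ⊤ := by
  have h : ρ.hull B v = ⊤ := by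
    refine (hρ.eq_bot_or_eq_top _ (fun w hw => ρ.parityOp_mem_hull hB hε hw)
      (fun x w hw => ρ.act_mem_hull_of_span hA hB hAB hv x hw)).resolve_left fun h0 => hv0 ?_
    have := ρ.mem_hull B v
    rwa [h0, Submodule.mem_bot] at this
  exact top_le_iff.1 (h ▸ ρ.hull_le hvU hU)

end Rep

/-! ### Weight shifts by matrix units -/

lemma sbracket_diagonal_matUnit (u : Idx p q r s → ℂ) (i j : Idx p q r s) :
    sbracket (Matrix.diagonal u) (matUnit i j) = (u i - u j) • matUnit i j := by
  rw [sbracket_even_left (diagonal_mem u)]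
  ext a b
  simp only [Matrix.sub_apply, Matrix.diagonal_mul, Matrix.mul_diagonal, matUnit_apply,
    Matrix.smul_apply, smul_eq_mul]
  split_ifs with h
  · obtain ⟨rfl, rfl⟩ := h
    ring
  · simp

namespace Rep

variable {V : Type*} [AddCommGroup V] [Module ℂ V]

lemma act_diagonal_matUnit (ρ : Rep p q r s V) (u : Idx p q r s → ℂ) (i j : Idx p q r s) (w : V) :
    ρ.act (Matrix.diagonal u) (ρ.act (matUnit i j) w) =
      ρ.act (matUnit i j) (ρ.act (Matrix.diagonal u) w) + (u i - u j) • ρ.act (matUnit i j) w := by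
  rw [ρ.act_act (diagonal_mem u) (matUnit_mem i j), sbracket_diagonal_matUnit, map_smul,
    LinearMap.smul_apply]
  simp [sgn, add_comm]

lemma act_matUnit_mem_eigenspace (ρ : Rep p q r s V) {u : Idx p q r s → ℂ} {c : ℂ} {w : V}
    (hw : w ∈ (ρ.act (Matrix.diagonal u)).eigenspace c) (i j : Idx p q r s) :
    ρ.act (matUnit i j) w ∈ (ρ.act (Matrix.diagonal u)).eigenspace (c + (u i - u j)) := by
  rw [Module.End.mem_eigenspace_iff] at *
  rw [act_diagonal_matUnit, hw, map_smul, add_smul]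

lemma parityOp_mem_eigenspace (ρ : Rep p q r s V) {u : Idx p q r s → ℂ} {c : ℂ} {w : V}
    (hw : w ∈ (ρ.act (Matrix.diagonal u)).eigenspace c) :
    ρ.parityOp w ∈ (ρ.act (Matrix.diagonal u)).eigenspace c := by
  rw [Module.End.mem_eigenspace_iff] at *
  have h := ρ.parityOp_act (diagonal_mem u) w
  rw [hw] at h
  simpa [sgn] using h.symm

lemma act_diagonal_of_weight (ρ : Rep p q r s V) {L : Idx p q r s → ℂ} {v : V}
    (h : ∀ i, ρ.act (matUnit i i) v = L i • v) (u : Idx p q r s → ℂ) :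
    ρ.act (Matrix.diagonal u) v = (∑ i, u i * L i) • v := by
  rw [diagonal_eq_sum, map_sum, LinearMap.sum_apply, Finset.sum_smul]
  refine Finset.sum_congr rfl fun i _ => ?_
  rw [map_smul, LinearMap.smul_apply, h, smul_smul]

/-! ### Highest weight vectors for the diagonal Cartan subalgebra -/

/-- `v` is a homogeneous highest weight vector of weight `L` for the diagonal Cartan subalgebra and
the positive system `{ε_i - ε_j | d j < d i}`. -/
structure IsHighest (ρ : Rep p q r s V) (d : Idx p q r s → ℤ) (L : Idx p q r s → ℂ) (ε : ℂ)
    (v : V) : Prop where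
  ne_zero : v ≠ 0
  parityOp_eq : ρ.parityOp v = ε • v
  weight : ∀ i, ρ.act (matUnit i i) v = L i • v
  raise : ∀ i j, d j < d i → ρ.act (matUnit i j) v = 0

/-- The matrix units of the opposite nilradical. -/
def lowering (d : Idx p q r s → ℤ) : Set (Mat p q r s) := {x | ∃ i j, d i < d j ∧ x = matUnit i j}

/-- The matrix units of the Borel subalgebra. -/
def raising (d : Idx p q r s → ℤ) : Set (Mat p q r s) := {x | ∃ i j, d j ≤ d i ∧ x = matUnit i j}

lemma lowering_homog (d : Idx p q r s → ℤ) : ∀ x ∈ lowering d, ∃ i, x ∈ homog p q r s i := by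
  rintro _ ⟨i, j, _, rfl⟩
  exact ⟨_, matUnit_mem i j⟩

lemma raising_homog (d : Idx p q r s → ℤ) : ∀ x ∈ raising d, ∃ i, x ∈ homog p q r s i := by
  rintro _ ⟨i, j, _, rfl⟩
  exact ⟨_, matUnit_mem i j⟩

lemma span_raising_lowering (d : Idx p q r s → ℤ) :
    Submodule.span ℂ (raising d ∪ lowering d) = ⊤ := by
  refine span_eq_top_of_matUnit_mem _ fun i j => Submodule.subset_span ?_
  rcases le_or_gt (d j) (d i) with h | h
  · exact Or.inl ⟨i, j, h, rfl⟩
  · exact Or.inr ⟨i, j, h, rfl⟩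

namespace IsHighest

variable {ρ : Rep p q r s V} {d : Idx p q r s → ℤ} {L : Idx p q r s → ℂ} {ε : ℂ} {v : V}

lemma raising_eigen (hv : ρ.IsHighest d L ε v) (hd : Function.Injective d) :
    ∀ x ∈ raising d, ∃ c : ℂ, ρ.act x v = c • v := by
  rintro _ ⟨i, j, hij, rfl⟩
  rcases hij.eq_or_lt with h | h
  · rw [hd h]
    exact ⟨_, hv.weight i⟩
  · exact ⟨0, by rw [hv.raise i j h, zero_smul]⟩

lemma eq_top_of_lowering (hv : ρ.IsHighest d L ε v) (hρ : ρ.IsIrreducible)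
    (hd : Function.Injective d) {U : Submodule ℂ V} (hvU : v ∈ U)
    (hU : ∀ i j, d i < d j → ∀ u ∈ U, ρ.act (matUnit i j) u ∈ U) : U = ⊤ := by
  refine hρ.eq_top_of_stable (raising_homog d) (lowering_homog d) (span_raising_lowering d)
    hv.ne_zero hv.parityOp_eq (hv.raising_eigen hd) hvU ?_
  rintro _ ⟨i, j, hij, rfl⟩ u hu
  exact hU i j hij u hu

/-- The linear form dual to a highest weight vector. -/
lemma exists_functional (hv : ρ.IsHighest d L ε v) (hρ : ρ.IsIrreducible)
    (hd : Function.Injective d) :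
    ∃ μ : Module.Dual ℂ V, μ v = 1 ∧
      (∀ i j, d i < d j → ∀ w, μ (ρ.act (matUnit i j) w) = 0) ∧
      (∀ i w, μ (ρ.act (matUnit i i) w) = L i * μ w) ∧
      ∀ w, μ (ρ.parityOp w) = ε * μ w := by
  set u : Idx p q r s → ℂ := fun i => d i with hu
  set c : ℂ := ∑ i, u i * L i with hc
  have hvc : v ∈ (ρ.act (Matrix.diagonal u)).eigenspace c := by
    rw [Module.End.mem_eigenspace_iff, ρ.act_diagonal_of_weight hv.weight]
  -- The diagonal matrix with entries `d` is a grading element: matrix units of the opposite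
  -- nilradical lower its eigenvalue by a positive integer. `X` collects the eigenspaces strictly
  -- below that of `v`, and the desired form is the projection to `v` along `X`.
  let X : Submodule ℂ V := ⨆ a : {a : ℂ // ∃ k : ℕ, 0 < k ∧ a = c - k},
    (ρ.act (Matrix.diagonal u)).eigenspace a
  have memX : ∀ k : ℕ, 0 < k → ∀ w ∈ (ρ.act (Matrix.diagonal u)).eigenspace (c - k), w ∈ X :=
    fun k hk w hw => Submodule.mem_iSup_of_mem (⟨c - k, k, hk, rfl⟩ :
      {a : ℂ // ∃ k : ℕ, 0 < k ∧ a = c - k}) hw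
  have indX : ∀ f : Module.End ℂ V,
      (∀ k : ℕ, 0 < k → ∀ w ∈ (ρ.act (Matrix.diagonal u)).eigenspace (c - k), f w ∈ X) →
      ∀ w ∈ X, f w ∈ X := by
    intro f hf
    change X ≤ X.comap f
    refine iSup_le ?_
    rintro ⟨_, k, hk, rfl⟩ w hw
    exact hf k hk w hw
  have lowX : ∀ i j, d i < d j → ∀ w ∈ (ρ.act (Matrix.diagonal u)).eigenspace c ⊔ X,
      ρ.act (matUnit i j) w ∈ X := by
    intro i j hij
    obtain ⟨m, hm⟩ := Int.eq_ofNat_of_zero_le (sub_pos.2 hij).le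
    have hm0 : 0 < m := by omega
    have hmu : u i - u j = -(m : ℂ) := by
      have : ((d j - d i : ℤ) : ℂ) = ((m : ℤ) : ℂ) := by rw [hm]
      push_cast at this
      rw [← this, hu]
      ring
    have key : ∀ k : ℕ, ∀ w ∈ (ρ.act (Matrix.diagonal u)).eigenspace (c - k),
        ρ.act (matUnit i j) w ∈ X := by
      intro k w hw
      refine memX (k + m) (by omega) _ ?_
      have := ρ.act_matUnit_mem_eigenspace hw i j
      rw [hmu] at this
      convert this using 2
      push_cast
      ring
    intro w hw
    obtain ⟨a, ha, b, hb, rfl⟩ := Submodule.mem_sup.1 hw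
    rw [map_add]
    exact X.add_mem (key 0 a (by simpa using ha)) (indX _ (fun k _ w hw => key k w hw) b hb)
  -- Eigenspaces for distinct eigenvalues are independent, and `c - k ≠ c` for `k > 0`.
  have hvX : v ∉ X := by
    intro h
    have hind := (ρ.act (Matrix.diagonal u)).eigenspaces_iSupIndep c
    refine hv.ne_zero (Submodule.disjoint_def.1 hind v hvc ?_)
    refine (iSup_le ?_ : X ≤ _) h
    rintro ⟨_, k, hk, rfl⟩
    refine le_iSup₂_of_le (c - k) ?_ le_rfl
    intro h
    have : (k : ℂ) = 0 := by linear_combination -h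
    exact hk.ne' (by exact_mod_cast this)
  have htop : Submodule.span ℂ {v} ⊔ X = ⊤ := by
    refine hv.eq_top_of_lowering hρ hd
      (Submodule.mem_sup_left (Submodule.mem_span_singleton_self v)) ?_
    intro i j hij w hw
    refine Submodule.mem_sup_right (lowX i j hij w ?_)
    refine sup_le_sup_right ?_ X hw
    rw [Submodule.span_singleton_le_iff_mem]
    exact hvc
  obtain ⟨f, hfv, hfX⟩ := Submodule.exists_le_ker_of_notMem hvX
  have hX0 : ∀ w ∈ X, f w = 0 := fun w hw => hfX hw
  have dec : ∀ w : V, ∃ a : ℂ, ∃ x ∈ X, w = a • v + x := by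
    intro w
    have hw : w ∈ Submodule.span ℂ {v} ⊔ X := htop ▸ Submodule.mem_top
    obtain ⟨y, hy, x, hx, rfl⟩ := Submodule.mem_sup.1 hw
    obtain ⟨a, rfl⟩ := Submodule.mem_span_singleton.1 hy
    exact ⟨a, x, hx, rfl⟩
  have eqv : ∀ (g : Module.End ℂ V) (b : ℂ), g v = b • v → (∀ w ∈ X, g w ∈ X) →
      ∀ w, f (g w) = b * f w := by
    intro g b hgv hgX w
    obtain ⟨a, x, hx, rfl⟩ := dec w
    simp only [map_add, map_smul, hgv, hX0 x hx, hX0 _ (hgX x hx), smul_eq_mul]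
    ring
  refine ⟨(f v)⁻¹ • f, by simp [hfv], ?_, ?_, ?_⟩
  · intro i j hij w
    obtain ⟨a, x, hx, rfl⟩ := dec w
    have := lowX i j hij (a • v + x) (Submodule.add_mem_sup (Submodule.smul_mem _ a hvc) hx)
    rw [LinearMap.smul_apply, hX0 _ this, smul_zero]
  · intro i w
    have := eqv (ρ.act (matUnit i i)) (L i) (hv.weight i) (indX _ fun k hk w hw => memX k hk _ (by
      simpa using ρ.act_matUnit_mem_eigenspace hw i i)) w
    simp only [LinearMap.smul_apply, this, smul_eq_mul]
    ring
  · intro w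
    have := eqv ρ.parityOp ε hv.parityOp_eq (indX _ fun k hk w hw => memX k hk _
      (ρ.parityOp_mem_eigenspace hw)) w
    simp only [LinearMap.smul_apply, this, smul_eq_mul]
    ring

/-- The dual linear form is a vector of weight `-L` in the dual representation. -/
lemma dual_isHighest {μ : Module.Dual ℂ V} (hμv : μ v = 1)
    (h1 : ∀ i j, d i < d j → ∀ w, μ (ρ.act (matUnit i j) w) = 0)
    (h2 : ∀ i w, μ (ρ.act (matUnit i i) w) = L i * μ w)
    (h3 : ∀ w, μ (ρ.parityOp w) = ε * μ w) :
    ρ.dual.IsHighest (fun i => -d i) (fun i => -L i) ε μ where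
  ne_zero := by
    rintro rfl
    simp at hμv
  parityOp_eq := by
    ext w
    rw [dual_parityOp, h3]
    rfl
  weight i := by
    ext w
    have hi : matUnit i i ∈ homog p q r s 0 := by
      have := matUnit_mem i i
      have h : ∀ c : ZMod 2, c + c = 0 := by decide
      rwa [h] at this
    change ρ.dualAct _ μ w = _
    rw [ρ.dualAct_even hi, h2]
    simp
  raise i j hij := by
    ext w
    change ρ.dualAct _ μ w = _
    have hm := matUnit_mem i j
    rcases zmod_two_cases (parity i + parity j) with h | h <;> rw [h] at hm
    · rw [ρ.dualAct_even hm, h1 i j (by omega)]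
      simp
    · rw [ρ.dualAct_odd hm, h3, h1 i j (by omega)]
      simp

end IsHighest

/-- No homogeneity of `μ` is needed: in the odd case the parity operator is applied after the matrix
unit, hence to zero. -/
lemma dual_act_matUnit_apply (ρ : Rep p q r s V) (i j : Idx p q r s) (μ : Module.Dual ℂ V)
    {v : V} (h : ρ.act (matUnit i j) v = 0) :
    ρ.dual.act (matUnit i j) μ v = 0 := by
  change ρ.dualAct _ μ v = _
  have hm := matUnit_mem i j
  rcases zmod_two_cases (parity i + parity j) with h' | h' <;> rw [h'] at hm
  · rw [ρ.dualAct_even hm, h]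
    simp
  · rw [ρ.dualAct_odd hm, h]
    simp

end Rep

namespace Rep

variable {V : Type*} [AddCommGroup V] [Module ℂ V]

/-! ### A criterion for self-duality -/

/-- An irreducible representation which has a highest weight vector of weight `L` and a lowest
weight vector of weight `-L`, of the same parity, is self-dual. -/
lemma isSelfDual_of_isHighest [FiniteDimensional ℂ V] {ρ : Rep p q r s V} (hρ : ρ.IsIrreducible)
    {d : Idx p q r s → ℤ} (hd : Function.Injective d) {L : Idx p q r s → ℂ} {ε : ℂ} {v v' : V}
    (hv : ρ.IsHighest d L ε v) (hv' : ρ.IsHighest (fun i => -d i) (fun i => -L i) ε v') :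
    ρ.IsSelfDual := by
  have hd' : Function.Injective (fun i => -d i) := neg_injective.comp hd
  obtain ⟨μ, hμv, h1, h2, h3⟩ := hv.exists_functional hρ hd
  obtain ⟨ν, hνv, n1, -, -⟩ := hv'.exists_functional hρ hd'
  have hμ : ρ.dual.IsHighest (fun i => -d i) (fun i => -L i) ε μ :=
    IsHighest.dual_isHighest hμv h1 h2 h3
  have hP : (ρ.prod ρ.dual).IsHighest (fun i => -d i) (fun i => -L i) ε (v', μ) :=
    { ne_zero := fun h => hv'.ne_zero (congrArg Prod.fst h)
      parityOp_eq := by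
        rw [prod_parityOp, hv'.parityOp_eq, hμ.parityOp_eq, Prod.smul_mk]
      weight := fun i => by
        rw [prod_act, hv'.weight, hμ.weight, Prod.smul_mk]
      raise := fun i j hij => by
        rw [prod_act, hv'.raise i j hij, hμ.raise i j hij, Prod.mk_zero_zero] }
  set N : Submodule ℂ (V × Module.Dual ℂ V) :=
    (ρ.prod ρ.dual).hull (lowering fun i => -d i) (v', μ) with hN
  have hmem : (v', μ) ∈ N := mem_hull _ _ _
  have hact : ∀ x, ∀ w ∈ N, (ρ.act x w.1, ρ.dual.act x w.2) ∈ N := fun x w hw =>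
    act_mem_hull_of_span _ (raising_homog _) (lowering_homog _) (span_raising_lowering _)
      (hP.raising_eigen hd') x hw
  have hpar : ∀ w ∈ N, (ρ.parityOp w.1, ρ.dual.parityOp w.2) ∈ N := fun w hw => by
    rw [← prod_parityOp]
    exact parityOp_mem_hull _ (lowering_homog _) hP.parityOp_eq hw
  -- Both sides equal `1` on the generator and vanish on every vector produced by a generating
  -- matrix unit: `ν` kills such images, and `v` is killed by these matrix units. Hence `(v', 0)` is
  -- not in `N`, which makes the projection to the dual injective.
  have hΦ : ∀ w ∈ N, w.2 v = ν w.1 := by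
    let U : Submodule ℂ (V × Module.Dual ℂ V) :=
      { carrier := {w | w.2 v = ν w.1}
        add_mem' := fun {a b} ha hb => by
          simp only [Set.mem_ofPred_eq] at *
          simp [ha, hb]
        zero_mem' := by simp
        smul_mem' := fun c a ha => by
          simp only [Set.mem_ofPred_eq] at *
          simp [ha] }
    have hle : N ≤ U := by
      refine hull_le _ (show μ v = ν v' by rw [hμv, hνv]) ?_
      rintro _ ⟨i, j, hij, rfl⟩ u -
      change ρ.dual.act (matUnit i j) u.2 v = ν (ρ.act (matUnit i j) u.1)
      rw [n1 i j hij, ρ.dual_act_matUnit_apply i j _ (hv.raise i j (neg_lt_neg_iff.1 hij))]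
    exact fun w hw => hle hw
  have fst_top : N.map (LinearMap.fst ℂ V (Module.Dual ℂ V)) = ⊤ := by
    refine (hρ.eq_bot_or_eq_top _ ?_ ?_).resolve_left ?_
    · rintro _ ⟨w, hw, rfl⟩
      exact ⟨_, hpar w hw, rfl⟩
    · rintro x _ ⟨w, hw, rfl⟩
      exact ⟨_, hact x w hw, rfl⟩
    · intro h
      have : v' ∈ N.map (LinearMap.fst ℂ V (Module.Dual ℂ V)) := ⟨_, hmem, rfl⟩
      rw [h, Submodule.mem_bot] at this
      exact hv'.ne_zero this
  have snd_inj : N.comap (LinearMap.inl ℂ V (Module.Dual ℂ V)) = ⊥ := by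
    refine (hρ.eq_bot_or_eq_top _ ?_ ?_).resolve_right ?_
    · intro w hw
      have := hpar _ hw
      simpa using this
    · intro x w hw
      have := hact x _ hw
      simpa using this
    · intro h
      have h0 : (v', (0 : Module.Dual ℂ V)) ∈ N := by
        have : v' ∈ N.comap (LinearMap.inl ℂ V (Module.Dual ℂ V)) := h ▸ Submodule.mem_top
        exact this
      have := hΦ _ h0
      simp [hνv] at this
  have inj2 : Function.Injective (Prod.snd ∘ N.subtype) := by
    change Function.Injective ((LinearMap.snd ℂ V (Module.Dual ℂ V)).comp N.subtype)
    rw [← LinearMap.ker_eq_bot, LinearMap.ker_eq_bot']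
    rintro ⟨⟨a, b⟩, hab⟩ h
    obtain rfl : b = 0 := h
    have : a ∈ N.comap (LinearMap.inl ℂ V (Module.Dual ℂ V)) := hab
    rw [snd_inj, Submodule.mem_bot] at this
    subst this
    rfl
  have surj1 : Function.Surjective (Prod.fst ∘ N.subtype) := by
    intro a
    have : a ∈ N.map (LinearMap.fst ℂ V (Module.Dual ℂ V)) := fst_top ▸ Submodule.mem_top
    obtain ⟨w, hw, rfl⟩ := this
    exact ⟨⟨w, hw⟩, rfl⟩
  -- The dimensions of `V`, `N` and `V^*` are squeezed together, so both projections are bijective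
  -- without irreducibility of the dual.
  have hdim1 : Module.finrank ℂ V ≤ Module.finrank ℂ N :=
    LinearMap.finrank_le_finrank_of_surjective
      (f := (LinearMap.fst ℂ V (Module.Dual ℂ V)).comp N.subtype) surj1
  have hdim2 : Module.finrank ℂ N ≤ Module.finrank ℂ (Module.Dual ℂ V) :=
    LinearMap.finrank_le_finrank_of_injective
      (f := (LinearMap.snd ℂ V (Module.Dual ℂ V)).comp N.subtype) inj2
  rw [Subspace.dual_finrank_eq] at hdim2
  have bij1 : Function.Bijective (Prod.fst ∘ N.subtype) :=
    ⟨(LinearMap.injective_iff_surjective_of_finrank_eq_finrank (hdim2.antisymm hdim1)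
      (f := (LinearMap.fst ℂ V (Module.Dual ℂ V)).comp N.subtype)).2 surj1, surj1⟩
  have bij2 : Function.Bijective (Prod.snd ∘ N.subtype) :=
    ⟨inj2, (LinearMap.injective_iff_surjective_of_finrank_eq_finrank
      ((hdim2.antisymm hdim1).trans Subspace.dual_finrank_eq.symm)
      (f := (LinearMap.snd ℂ V (Module.Dual ℂ V)).comp N.subtype)).1 inj2⟩
  obtain ⟨f, hf⟩ := Submodule.exists_equiv_eq_graph bij1 bij2
  have memf : ∀ a, (a, f a) ∈ N := fun a => by
    rw [hf]
    exact (LinearMap.mem_graph_iff _ _).2 rfl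
  have eqf : ∀ w ∈ N, w.2 = f w.1 := fun w hw => by
    rw [hf] at hw
    exact (LinearMap.mem_graph_iff _ _).1 hw
  refine ⟨f, fun i a ha => ρ.dual.mem_gr_of_parityOp ?_, fun x a => (eqf _ (hact x _ (memf a))).symm⟩
  have := eqf _ (hpar _ (memf a))
  simp only at this
  rw [this, ρ.parityOp_of_mem ha, map_smul]

/-! ### The action of a diagonal involution -/

/-- The operator by which a diagonal involution acts on an irreducible representation. -/
lemma IsIrreducible.exists_sign_operator [FiniteDimensional ℂ V] {ρ : Rep p q r s V}
    (hρ : ρ.IsIrreducible) (z : Idx p q r s → ℤ) :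
    ∃ S : Module.End ℂ V, Function.Injective S ∧ (∀ w, S (ρ.parityOp w) = ρ.parityOp (S w)) ∧
      ∀ i j w, S (ρ.act (matUnit i j) w) =
        ((-1 : ℂ) ^ (z i - z j)) • ρ.act (matUnit i j) (S w) := by
  have := hρ.1
  set D := ρ.act (Matrix.diagonal fun i => (z i : ℂ)) with hD
  obtain ⟨c, hc⟩ := Module.End.exists_eigenvalue D
  -- Matrix units shift eigenvalues of `D` by integers. The operator sought is `(-1)^k` on the
  -- eigenspace of `c + k`, so these eigenspaces are grouped by the parity of `k`.
  let X : ZMod 2 → Submodule ℂ V := fun e =>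
    ⨆ a : {a : ℂ // ∃ k : ℤ, (k : ZMod 2) = e ∧ a = c + k}, D.eigenspace a
  have memX : ∀ k : ℤ, ∀ w ∈ D.eigenspace (c + k), w ∈ X k :=
    fun k w hw => Submodule.mem_iSup_of_mem (⟨c + k, k, rfl, rfl⟩ :
      {a : ℂ // ∃ k' : ℤ, (k' : ZMod 2) = (k : ZMod 2) ∧ a = c + k'}) hw
  have indX : ∀ (f : Module.End ℂ V) (e e' : ZMod 2),
      (∀ k : ℤ, (k : ZMod 2) = e → ∀ w ∈ D.eigenspace (c + k), f w ∈ X e') →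
      ∀ w ∈ X e, f w ∈ X e' := by
    intro f e e' hf
    change X e ≤ (X e').comap f
    refine iSup_le ?_
    rintro ⟨_, k, hk, rfl⟩ w hw
    exact hf k hk w hw
  have actX : ∀ i j e, ∀ w ∈ X e, ρ.act (matUnit i j) w ∈ X (e + (z i - z j : ℤ)) := by
    intro i j e
    refine indX _ _ _ ?_
    rintro k rfl w hw
    rw [← Int.cast_add]
    refine memX _ _ ?_
    convert ρ.act_matUnit_mem_eigenspace hw i j using 2
    push_cast
    ring
  have parX : ∀ e, ∀ w ∈ X e, ρ.parityOp w ∈ X e := by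
    intro e
    refine indX _ _ _ ?_
    rintro k rfl w hw
    exact memX _ _ (ρ.parityOp_mem_eigenspace hw)
  have hdisj : Disjoint (X 0) (X 1) := by
    have hind := D.eigenspaces_iSupIndep
    have := hind.disjoint_biSup_biSup (s := {a : ℂ | ∃ k : ℤ, (k : ZMod 2) = 0 ∧ a = c + k})
      (t := {a : ℂ | ∃ k : ℤ, (k : ZMod 2) = 1 ∧ a = c + k}) (by
        rw [Set.disjoint_left]
        rintro _ ⟨k, hk, rfl⟩ ⟨l, hl, h⟩
        have : k = l := by exact_mod_cast add_left_cancel h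
        subst this
        exact zero_ne_one (hk.symm.trans hl))
    simpa only [X, iSup_subtype, Set.mem_ofPred_eq] using this
  -- The sum is a nonzero graded submodule; diagonalizability of `D` is thus a consequence of
  -- irreducibility.
  have htop : X 0 ⊔ X 1 = ⊤ := by
    have hX : ∀ e : ZMod 2, X e ≤ X 0 ⊔ X 1 := fun e => by
      rcases zmod_two_cases e with rfl | rfl
      exacts [le_sup_left, le_sup_right]
    refine (hρ.eq_bot_or_eq_top _ ?_ ?_).resolve_left ?_
    · intro v hv
      obtain ⟨a, ha, b, hb, rfl⟩ := Submodule.mem_sup.1 hv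
      rw [map_add]
      exact Submodule.add_mem_sup (parX 0 a ha) (parX 1 b hb)
    · intro x v hv
      obtain ⟨a, ha, b, hb, rfl⟩ := Submodule.mem_sup.1 hv
      rw [eq_sum_matUnit x]
      simp only [map_sum, LinearMap.sum_apply, map_smul, LinearMap.smul_apply]
      refine Submodule.sum_mem _ fun i _ => Submodule.sum_mem _ fun j _ =>
        Submodule.smul_mem _ _ ?_
      rw [map_add]
      exact Submodule.add_mem _ (hX _ (actX i j 0 a ha)) (hX _ (actX i j 1 b hb))
    · intro h
      obtain ⟨w, hw, hw0⟩ := hc.exists_hasEigenvector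
      refine hw0 ?_
      have : w ∈ X 0 ⊔ X 1 := hX _ (memX 0 w (by simpa using hw))
      rwa [h, Submodule.mem_bot] at this
  have hcompl : IsCompl (X 0) (X 1) := ⟨hdisj, codisjoint_iff.2 htop⟩
  let S : Module.End ℂ V := Submodule.projection _ _ hcompl - Submodule.projection _ _ hcompl.symm
  have hS : ∀ k : ℤ, ∀ w ∈ X k, S w = ((-1 : ℂ) ^ k) • w := by
    intro k w hw
    rcases Int.even_or_odd k with hk | hk
    · have : (k : ZMod 2) = 0 := (ZMod.intCast_zmod_eq_zero_iff_dvd k 2).2 hk.two_dvd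
      rw [this] at hw
      simp [S, Submodule.projection_apply_of_mem_left _ hw,
        Submodule.projection_apply_of_mem_right _ hw, hk.neg_one_zpow]
    · have : (k : ZMod 2) = 1 := by
        obtain ⟨m, rfl⟩ := hk
        have h2 : (2 : ZMod 2) = 0 := by decide
        push_cast
        rw [h2]
        ring
      rw [this] at hw
      simp [S, Submodule.projection_apply_of_mem_left _ hw,
        Submodule.projection_apply_of_mem_right _ hw, hk.neg_one_zpow]
  have dec : ∀ w : V, ∃ a ∈ X (0 : ℤ), ∃ b ∈ X (1 : ℤ), a + b = w := fun w => by
    simpa using Submodule.mem_sup.1 (htop ▸ Submodule.mem_top : w ∈ X 0 ⊔ X 1)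
  refine ⟨S, ?_, ?_, ?_⟩
  · refine Function.LeftInverse.injective (g := S) fun w => ?_
    obtain ⟨a, ha, b, hb, rfl⟩ := dec w
    simp [hS 0 a ha, hS 1 b hb]
  · intro w
    obtain ⟨a, ha, b, hb, rfl⟩ := dec w
    simp only [map_add, hS 0 a ha, hS 1 b hb, hS 0 _ (parX _ a ha), hS 1 _ (parX _ b hb), map_smul]
  · intro i j w
    have key : ∀ k : ℤ, ∀ w ∈ X k, S (ρ.act (matUnit i j) w) =
        ((-1 : ℂ) ^ (z i - z j)) • ρ.act (matUnit i j) (S w) := by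
      intro k w hw
      have := actX i j _ w hw
      rw [← Int.cast_add] at this
      rw [hS _ _ this, hS _ _ hw, map_smul, smul_smul, ← zpow_add₀ (by norm_num), add_comm]
    obtain ⟨a, ha, b, hb, rfl⟩ := dec w
    simp only [map_add, key 0 a ha, key 1 b hb, smul_add]

end Rep

lemma parity_add_self (i : Idx p q r s) : parity i + parity i = 0 := by
  have h : ∀ c : ZMod 2, c + c = 0 := by decide
  exact h _

lemma matUnit_self_mem (i : Idx p q r s) : matUnit i i ∈ homog p q r s 0 :=
  parity_add_self i ▸ matUnit_mem i i

lemma matUnit_self_eq_diagonal (i : Idx p q r s) :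
    matUnit i i = Matrix.diagonal (Pi.single i (1 : ℂ)) := by
  rw [Matrix.diagonal_single]
  rfl

namespace Rep

variable {V : Type*} [AddCommGroup V] [Module ℂ V]

lemma act_matUnit_self_matUnit (ρ : Rep p q r s V) (k i j : Idx p q r s) (w : V) :
    ρ.act (matUnit k k) (ρ.act (matUnit i j) w) = ρ.act (matUnit i j) (ρ.act (matUnit k k) w) +
      ((Pi.single k (1 : ℂ) : Idx p q r s → ℂ) i - (Pi.single k (1 : ℂ) : Idx p q r s → ℂ) j) •
        ρ.act (matUnit i j) w := by
  rw [matUnit_self_eq_diagonal k, act_diagonal_matUnit]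

/-! ### From highest weight vectors to lowest weight vectors -/

namespace IsHighest

variable {ρ : Rep p q r s V} {d : Idx p q r s → ℤ} {L : Idx p q r s → ℂ} {ε : ℂ} {v : V}

/-- A vector obtained by lowering a highest weight vector cannot be a highest weight vector. -/
lemma act_eq_zero (hv : ρ.IsHighest d L ε v) (hρ : ρ.IsIrreducible) (hd : Function.Injective d)
    {i j : Idx p q r s} (hij : i ≠ j)
    (h : ∀ k l, d l < d k → ρ.act (matUnit k l) (ρ.act (matUnit i j) v) = 0) :
    ρ.act (matUnit i j) v = 0 := by
  by_contra hw
  set w := ρ.act (matUnit i j) v with hw'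
  let L' : Idx p q r s → ℂ := fun k => L k +
    ((Pi.single k (1 : ℂ) : Idx p q r s → ℂ) i - (Pi.single k (1 : ℂ) : Idx p q r s → ℂ) j)
  have hwH : ρ.IsHighest d L' (sgn (parity i + parity j) (parity i + parity j) * ε) w :=
    { ne_zero := hw
      parityOp_eq := by
        rw [hw', ρ.parityOp_act (matUnit_mem i j), hv.parityOp_eq, map_smul, smul_smul]
      weight := fun k => by
        rw [hw', act_matUnit_self_matUnit, hv.weight, map_smul, add_smul]
      raise := h }
  obtain ⟨μ, hμw, h1, h2, -⟩ := hwH.exists_functional hρ hd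
  -- The weight of `w` at `i` is `L i + 1`, while `v` has weight `L i` there, so evaluating `μ` on
  -- `matUnit i i` applied to `v` in two ways gives zero. Then `μ` vanishes on all that is generated
  -- from `v`, including `w`.
  have hμv : μ v = 0 := by
    have := h2 i v
    rw [hv.weight i, map_smul, smul_eq_mul] at this
    simp only [L', Pi.single_eq_same, Pi.single_eq_of_ne hij.symm] at this
    linear_combination -this
  have hker : LinearMap.ker μ = ⊤ :=
    hv.eq_top_of_lowering hρ hd (LinearMap.mem_ker.2 hμv) fun i j hij u _ =>
      LinearMap.mem_ker.2 (h1 i j hij u)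
  rw [LinearMap.ker_eq_top] at hker
  simp [hker] at hμw

/-- A highest weight vector for the order twisted by an involution `π` which reverses the order
except on its fixed points, whose weight vanishes on the fixed points, is a lowest weight vector
for the original order. -/
lemma isLowest {π : Idx p q r s → Idx p q r s} (hπ : Function.Involutive π)
    (hd : Function.Injective d) (hρ : ρ.IsIrreducible)
    (hc : ∀ i j, (π i ≠ i ∨ π j ≠ j) → d j < d i → d (π i) < d (π j))
    (hL : ∀ i, π i = i → L i = 0)
    (hv : ρ.IsHighest (fun i => d (π i)) L ε v) : ρ.IsHighest (fun i => -d i) L ε v := by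
  have hdπ : Function.Injective fun i => d (π i) := hd.comp hπ.injective
  -- Between two fixed indices the twisted order agrees with `d`, so annihilation by the lowering
  -- matrix units has to be proved, by induction on the height gap. It suffices that the lowered
  -- vector is singular; only the commutator terms with `l = i` or `j = k` matter.
  have key : ∀ n : ℕ, ∀ i j, π i = i → π j = j → d i < d j → d j - d i ≤ n →
      ρ.act (matUnit i j) v = 0 := by
    intro n
    induction n with
    | zero => intro i j _ _ h1 h2; push_cast at h2; omega
    | succ n ih =>
      intro i j hi hj hij hn
      push_cast at hn
      have hdiag : ∀ k, π k = k → ρ.act (matUnit k k) v = 0 := fun k hk => by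
        rw [hv.weight, hL k hk, zero_smul]
      refine hv.act_eq_zero hρ hdπ (fun h => by simp [h] at hij) fun k l hkl => ?_
      have hA : l = i → ρ.act (matUnit k j) v = 0 := by
        rintro rfl
        rw [hi] at hkl
        by_cases hkj : k = j
        · rw [hkj, hdiag j hj]
        by_cases hk : π k = k
        · rw [hk] at hkl
          rcases lt_or_gt_of_ne (fun h => hkj (hd h)) with h | h
          · exact ih k j hk hj h (by omega)
          · exact hv.raise k j (by rwa [hk, hj])
        -- A non-fixed `k` higher than the fixed `l` would be moved below `l` by `π`, against `hkl`.
        · have h1 : d k < d l := by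
            rcases lt_trichotomy (d k) (d l) with h | h | h
            · exact h
            · exact absurd (hd h ▸ hi) hk
            · have := hc k l (Or.inl hk) h
              rw [hi] at this
              omega
          exact hv.raise k j (hc j k (Or.inr hk) (h1.trans hij))
      have hB : j = k → ρ.act (matUnit i l) v = 0 := by
        rintro rfl
        rw [hj] at hkl
        by_cases hli : l = i
        · rw [hli, hdiag i hi]
        by_cases hl : π l = l
        · rw [hl] at hkl
          rcases lt_or_gt_of_ne (fun h => hli (hd h)) with h | h
          · exact hv.raise i l (by rwa [hi, hl])
          · exact ih i l hi hl h (by omega)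
        · have h1 : d j < d l := by
            rcases lt_trichotomy (d j) (d l) with h | h | h
            · exact h
            · exact absurd (hd h ▸ hj) hl
            · have := hc j l (Or.inr hl) h
              rw [hj] at this
              omega
          exact hv.raise i l (hc l i (Or.inl hl) (hij.trans h1))
      rw [ρ.act_act (matUnit_mem k l) (matUnit_mem i j), hv.raise k l hkl, map_zero, smul_zero,
        add_zero, sbracket_of_mem (matUnit_mem k l) (matUnit_mem i j), matUnit_mul, matUnit_mul,
        map_sub, LinearMap.sub_apply, map_smul, LinearMap.smul_apply]
      split_ifs with h1 h2 h2
      · rw [hA h1, hB h2, smul_zero, sub_zero]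
      · simp [hA h1]
      · simp [hB h2]
      · simp
  refine ⟨hv.ne_zero, hv.parityOp_eq, hv.weight, fun i j hij => ?_⟩
  have hij : d i < d j := neg_lt_neg_iff.1 hij
  by_cases h : π i ≠ i ∨ π j ≠ j
  · exact hv.raise i j (hc j i h.symm hij)
  · push Not at h
    exact key (d j - d i).toNat i j h.1 h.2 hij (Int.self_le_toNat _)

end IsHighest

end Rep

/-! ### Conjugation by even invertible matrices -/

lemma eq_zero_of_mem_homog {x : Mat p q r s} (h0 : x ∈ homog p q r s 0)
    (h1 : x ∈ homog p q r s 1) : x = 0 := by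
  rw [← part_of_mem h0, part_of_mem_ne zero_ne_one h1]

lemma one_mem_homog : (1 : Mat p q r s) ∈ homog p q r s 0 := by
  rw [← Matrix.diagonal_one]
  exact diagonal_mem _

/-- The product of `g` with the odd part of its inverse is odd, but it is also `1` minus an even
matrix; hence it is zero, and `g` can be cancelled. -/
lemma inv_mem_homog {g : (Mat p q r s)ˣ} (hg : (g : Mat p q r s) ∈ homog p q r s 0) :
    ((g⁻¹ : (Mat p q r s)ˣ) : Mat p q r s) ∈ homog p q r s 0 := by
  set y : Mat p q r s := ((g⁻¹ : (Mat p q r s)ˣ) : Mat p q r s) with hy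
  have h1 : (g : Mat p q r s) * part 0 y + g * part 1 y = 1 := by
    rw [← mul_add, part_add_part, hy, Units.mul_inv]
  have h2 : (g : Mat p q r s) * part 1 y = 0 := by
    refine eq_zero_of_mem_homog ?_ (by simpa using mul_mem_homog hg (part_mem 1 y))
    rw [eq_sub_of_add_eq' h1]
    exact Submodule.sub_mem _ one_mem_homog (by simpa using mul_mem_homog hg (part_mem 0 y))
  have h3 : part 1 y = 0 := by
    have := congrArg (fun z => y * z) h2
    simpa [hy, ← mul_assoc] using this
  rw [← part_add_part y, h3, add_zero]
  exact part_mem 0 y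

/-- Conjugation by an invertible matrix. -/
def conjMap (g : (Mat p q r s)ˣ) : Mat p q r s →ₗ[ℂ] Mat p q r s where
  toFun x := g * x * (g⁻¹ : (Mat p q r s)ˣ)
  map_add' x y := by rw [mul_add, add_mul]
  map_smul' c x := by simp

lemma conjMap_apply (g : (Mat p q r s)ˣ) (x : Mat p q r s) :
    conjMap g x = g * x * (g⁻¹ : (Mat p q r s)ˣ) := rfl

lemma conjMap_mul (g : (Mat p q r s)ˣ) (x y : Mat p q r s) :
    conjMap g (x * y) = conjMap g x * conjMap g y := by
  simp [conjMap_apply, mul_assoc]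

lemma conjMap_conjMap_inv (g : (Mat p q r s)ˣ) (x : Mat p q r s) :
    conjMap g (conjMap g⁻¹ x) = x := by
  simp [conjMap_apply, mul_assoc]

lemma conjMap_inv_conjMap (g : (Mat p q r s)ˣ) (x : Mat p q r s) :
    conjMap g⁻¹ (conjMap g x) = x := by
  simp [conjMap_apply, mul_assoc]

lemma conjMap_injective (g : (Mat p q r s)ˣ) : Function.Injective (conjMap g) :=
  Function.LeftInverse.injective (conjMap_inv_conjMap g)

lemma conjMap_mem {g : (Mat p q r s)ˣ} (hg : (g : Mat p q r s) ∈ homog p q r s 0) {i : ZMod 2}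
    {x : Mat p q r s} (hx : x ∈ homog p q r s i) : conjMap g x ∈ homog p q r s i := by
  have := mul_mem_homog (mul_mem_homog hg hx) (inv_mem_homog hg)
  rwa [zero_add, add_zero] at this

lemma part_conjMap {g : (Mat p q r s)ˣ} (hg : (g : Mat p q r s) ∈ homog p q r s 0) (i : ZMod 2)
    (x : Mat p q r s) : part i (conjMap g x) = conjMap g (part i x) := by
  conv_lhs => rw [← part_add_part x]
  rw [map_add, map_add]
  rcases zmod_two_cases i with rfl | rfl
  · rw [part_of_mem (conjMap_mem hg (part_mem 0 x)),
      part_of_mem_ne zero_ne_one (conjMap_mem hg (part_mem 1 x)), add_zero]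
  · rw [part_of_mem (conjMap_mem hg (part_mem 1 x)),
      part_of_mem_ne one_ne_zero (conjMap_mem hg (part_mem 0 x)), zero_add]

lemma conjMap_sbracket {g : (Mat p q r s)ˣ} (hg : (g : Mat p q r s) ∈ homog p q r s 0)
    (x y : Mat p q r s) : conjMap g (sbracket x y) = sbracket (conjMap g x) (conjMap g y) := by
  simp only [sbracket, part_conjMap hg, map_sum, map_sub, map_smul, conjMap_mul]

namespace Rep

variable {V : Type*} [AddCommGroup V] [Module ℂ V]

/-- The representation twisted by conjugation. -/
def conj (ρ : Rep p q r s V) (g : (Mat p q r s)ˣ) (hg : (g : Mat p q r s) ∈ homog p q r s 0) :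
    Rep p q r s V where
  gr := ρ.gr
  isCompl := ρ.isCompl
  act := ρ.act.comp (conjMap g)
  act_mem i j x hx v hv := ρ.act_mem i j _ (conjMap_mem hg hx) v hv
  act_sbracket i j x hx y hy := by
    rw [LinearMap.comp_apply, conjMap_sbracket hg]
    exact ρ.act_sbracket i j _ (conjMap_mem hg hx) _ (conjMap_mem hg hy)

variable {ρ : Rep p q r s V} {g : (Mat p q r s)ˣ} {hg : (g : Mat p q r s) ∈ homog p q r s 0}

lemma conj_act (x : Mat p q r s) : (ρ.conj g hg).act x = ρ.act (conjMap g x) := rfl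

lemma conj_parityOp : (ρ.conj g hg).parityOp = ρ.parityOp := rfl

lemma IsIrreducible.conj (hρ : ρ.IsIrreducible) : (ρ.conj g hg).IsIrreducible := by
  refine ⟨hρ.1, fun U hU hx => hρ.2 U hU fun x v hv => ?_⟩
  have := hx (conjMap g⁻¹ x) v hv
  rwa [conj_act, conjMap_conjMap_inv] at this

/-- The same map works: twisting by an even `g` commutes with dualizing, because the parity operator
is unchanged and conjugation respects homogeneous parts. -/
lemma IsSelfDual.of_conj (h : (ρ.conj g hg).IsSelfDual) : ρ.IsSelfDual := by
  obtain ⟨f, hf, hfx⟩ := h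
  refine ⟨f, hf, fun x v => ?_⟩
  have := hfx (conjMap g⁻¹ x) v
  rw [conj_act, conjMap_conjMap_inv] at this
  rw [this]
  ext w
  change (ρ.conj g hg).dualAct (conjMap g⁻¹ x) (f v) w = ρ.dualAct x (f v) w
  simp only [dualAct, LinearMap.coe_mk, AddHom.coe_mk, conj_act, conj_parityOp,
    ← part_conjMap hg, conjMap_conjMap_inv]

end Rep

/-! ### The involution in adapted coordinates -/

/-- The diagonal entries of `σ`. -/
def sigmaSign : Idx p q r s → ℂ :=
  Sum.elim (Sum.elim (fun _ => 1) (fun _ => -1)) (Sum.elim (fun _ => 1) (fun _ => -1))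

lemma sigma_eq : sigma p q r s = Matrix.diagonal sigmaSign := rfl

lemma sigmaSign_mul_self (i : Idx p q r s) : sigmaSign i * sigmaSign i = 1 := by
  rcases i with (i | i) | (i | i) <;> simp [sigmaSign]

lemma sigma_mul_self : sigma p q r s * sigma p q r s = 1 := by
  rw [sigma_eq, Matrix.diagonal_mul_diagonal, ← Matrix.diagonal_one]
  congr 1
  funext i
  exact sigmaSign_mul_self i

lemma theta_eq (x : Mat p q r s) : theta x = sigma p q r s * x * sigma p q r s := by
  rw [theta, Matrix.inv_eq_right_inv sigma_mul_self]

lemma theta_theta (x : Mat p q r s) : theta (theta x) = x := by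
  have h : sigma p q r s * (sigma p q r s * x * sigma p q r s) * sigma p q r s =
      (sigma p q r s * sigma p q r s) * x * (sigma p q r s * sigma p q r s) := by
    simp only [mul_assoc]
  rw [theta_eq, theta_eq, h, sigma_mul_self, one_mul, mul_one]

lemma theta_add (x y : Mat p q r s) : theta (x + y) = theta x + theta y := by
  simp only [theta_eq, mul_add, add_mul]

lemma theta_neg (x : Mat p q r s) : theta (-x) = -theta x := by
  simp only [theta_eq, mul_neg, neg_mul]

lemma theta_sub (x y : Mat p q r s) : theta (x - y) = theta x - theta y := by
  rw [sub_eq_add_neg, theta_add, theta_neg, sub_eq_add_neg]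

lemma theta_smul (c : ℂ) (x : Mat p q r s) : theta (c • x) = c • theta x := by
  simp [theta_eq]

lemma theta_mem {i : ZMod 2} {x : Mat p q r s} (hx : x ∈ homog p q r s i) :
    theta x ∈ homog p q r s i := by
  rw [theta_eq, sigma_eq]
  have := mul_mem_homog (mul_mem_homog (diagonal_mem sigmaSign) hx) (diagonal_mem sigmaSign)
  rwa [zero_add, add_zero] at this

lemma mem_kPart {x : Mat p q r s} : x ∈ kPart p q r s ↔ theta x = x := Iff.rfl

lemma mem_pPart {x : Mat p q r s} : x ∈ pPart p q r s ↔ theta x = -x := Iff.rfl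

/-- The monomial matrix with entries `t i` in the places `(i, π i)`. -/
def monomial (π : Idx p q r s → Idx p q r s) (t : Idx p q r s → ℂ) : Mat p q r s :=
  Matrix.of fun i j => if j = π i then t i else 0

/-- Conjugation by an involutive monomial matrix. -/
def twist (π : Idx p q r s → Idx p q r s) (t : Idx p q r s → ℂ) (x : Mat p q r s) :
    Mat p q r s :=
  Matrix.of fun i j => t i * t (π j) * x (π i) (π j)

/-- The columns of `g` form a homogeneous basis in which `σ` is the monomial matrix given by
`π` and `t`. -/
structure IsAdapted (g : (Mat p q r s)ˣ) (π : Idx p q r s → Idx p q r s) (t : Idx p q r s → ℂ) :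
    Prop where
  even : (g : Mat p q r s) ∈ homog p q r s 0
  invol : Function.Involutive π
  mul_eq_one : ∀ i, t i * t (π i) = 1
  sigma_mul : sigma p q r s * g = g * monomial π t

namespace IsAdapted

variable {g : (Mat p q r s)ˣ} {π : Idx p q r s → Idx p q r s} {t : Idx p q r s → ℂ}

lemma ne_zero (h : IsAdapted g π t) (i : Idx p q r s) : t i ≠ 0 := fun h0 => by
  simpa [h0] using h.mul_eq_one i

lemma monomial_mul_mul (h : IsAdapted g π t) (x : Mat p q r s) :
    monomial π t * x * monomial π t = twist π t x := by
  ext i j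
  simp only [Matrix.mul_apply, monomial, twist, Matrix.of_apply]
  rw [Finset.sum_eq_single (π j)]
  · rw [Finset.sum_eq_single (π i)]
    · simp only [if_true, h.invol j]
      ring
    · intro b _ hb
      rw [if_neg hb, zero_mul]
    · simp
  · intro b _ hb
    rw [if_neg, mul_zero]
    rintro rfl
    exact hb (h.invol b).symm
  · simp

/-- From `σ g = g M`, with `M` monomial, follows `g⁻¹ σ = M g⁻¹`, so in the basis `g` the involution
is `x ↦ M x M`. -/
lemma theta_conjMap (h : IsAdapted g π t) (x : Mat p q r s) :
    theta (conjMap g x) = conjMap g (twist π t x) := by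
  have h2 : ((g⁻¹ : (Mat p q r s)ˣ) : Mat p q r s) * sigma p q r s =
      monomial π t * (g⁻¹ : (Mat p q r s)ˣ) := by
    rw [Units.inv_mul_eq_iff_eq_mul, ← mul_assoc, ← h.sigma_mul, mul_assoc, Units.mul_inv,
      mul_one]
  rw [theta_eq, conjMap_apply, conjMap_apply, ← h.monomial_mul_mul, ← mul_assoc, ← mul_assoc,
    h.sigma_mul, mul_assoc, mul_assoc, mul_assoc, h2]
  simp only [mul_assoc]

lemma twist_matUnit (h : IsAdapted g π t) (i j : Idx p q r s) :
    twist π t (matUnit i j) = (t (π i) * t j) • matUnit (π i) (π j) := by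
  ext a b
  simp only [twist, Matrix.of_apply, Matrix.smul_apply, matUnit_apply, smul_eq_mul]
  have e : ∀ k l, k = π l ↔ π k = l := fun k l =>
    ⟨fun e => by rw [e, h.invol], fun e => by rw [← e, h.invol]⟩
  simp only [e i a, e j b]
  split_ifs with hab
  · obtain ⟨rfl, rfl⟩ := hab
    rw [h.invol]
  · simp

lemma theta_conjMap_matUnit (h : IsAdapted g π t) (i j : Idx p q r s) :
    theta (conjMap g (matUnit i j)) =
      (t (π i) * t j) • conjMap g (matUnit (π i) (π j)) := by
  rw [h.theta_conjMap, h.twist_matUnit, map_smul]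

/-- These elements of `𝔥 ∩ 𝔨` are what turns vanishing of a weight on `𝔨` into `L i + L (π i) = 0`.
-/
lemma conjMap_add_mem_kPart (h : IsAdapted g π t) (i : Idx p q r s) :
    conjMap g (matUnit i i + matUnit (π i) (π i)) ∈ kPart p q r s := by
  rw [mem_kPart, map_add, theta_add, h.theta_conjMap_matUnit, h.theta_conjMap_matUnit, h.invol,
    mul_comm, h.mul_eq_one, one_smul, one_smul, add_comm]

end IsAdapted

/-! ### The operator of `θ` and self-duality from a compatible order -/

namespace Rep

variable {V : Type*} [AddCommGroup V] [Module ℂ V]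

/-- As `θ` is inner, it is implemented by an operator on every irreducible representation. -/
lemma IsIrreducible.exists_theta_operator [FiniteDimensional ℂ V] {ρ : Rep p q r s V}
    (hρ : ρ.IsIrreducible) :
    ∃ S : Module.End ℂ V, Function.Injective S ∧ (∀ w, S (ρ.parityOp w) = ρ.parityOp (S w)) ∧
      ∀ x w, S (ρ.act x w) = ρ.act (theta x) (S w) := by
  -- An integral logarithm of `σ`: the entries of `σ` are `(-1) ^ z i`.
  let z : Idx p q r s → ℤ :=
    Sum.elim (Sum.elim (fun _ => 0) (fun _ => 1)) (Sum.elim (fun _ => 0) (fun _ => 1))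
  have hz : ∀ i j, ((-1 : ℂ) ^ (z i - z j)) = sigmaSign i * sigmaSign j := by
    rintro ((i | i) | (i | i)) ((j | j) | (j | j)) <;> simp [z, sigmaSign]
  obtain ⟨S, hS, hP, hE⟩ := hρ.exists_sign_operator z
  refine ⟨S, hS, hP, fun x w => ?_⟩
  have hθ : theta x = ∑ i, ∑ j, (x i j * (sigmaSign i * sigmaSign j)) • matUnit i j := by
    rw [eq_sum_matUnit (theta x)]
    refine Finset.sum_congr rfl fun i _ => Finset.sum_congr rfl fun j _ => ?_
    rw [theta_eq, sigma_eq, Matrix.mul_diagonal, Matrix.diagonal_mul]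
    congr 1
    ring
  rw [hθ]
  conv_lhs => rw [eq_sum_matUnit x]
  simp only [map_sum, LinearMap.sum_apply, map_smul, LinearMap.smul_apply, hE, hz, smul_smul]

/-- Self-duality from a highest weight vector for an order compatible with the involution. -/
lemma isSelfDual_of_isAdapted [FiniteDimensional ℂ V] {ρ : Rep p q r s V} (hρ : ρ.IsIrreducible)
    {g : (Mat p q r s)ˣ} {π : Idx p q r s → Idx p q r s} {t : Idx p q r s → ℂ}
    (h : IsAdapted g π t) {d : Idx p q r s → ℤ} (hd : Function.Injective d)
    (hc : ∀ i j, (π i ≠ i ∨ π j ≠ j) → d j < d i → d (π i) < d (π j))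
    {L : Idx p q r s → ℂ} (hL : ∀ i, L i + L (π i) = 0) {ε : ℂ} {v : V}
    (hv : (ρ.conj g h.even).IsHighest d L ε v) : ρ.IsSelfDual := by
  obtain ⟨S, hS, hP, hθ⟩ := hρ.exists_theta_operator
  have hSE : ∀ i j, S ((ρ.conj g h.even).act (matUnit (π i) (π j)) v) =
      (t i * t (π j)) • (ρ.conj g h.even).act (matUnit i j) (S v) := fun i j => by
    rw [conj_act, conj_act, hθ, h.theta_conjMap_matUnit, h.invol, h.invol, map_smul,
      LinearMap.smul_apply]
  have hv' : (ρ.conj g h.even).IsHighest (fun i => d (π i)) (fun i => -L i) ε (S v) :=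
    { ne_zero := fun h0 => hv.ne_zero (hS (by rw [h0, map_zero]))
      parityOp_eq := by
        rw [conj_parityOp, ← hP, ← conj_parityOp (hg := h.even), hv.parityOp_eq, map_smul]
      weight := fun i => by
        have := hSE i i
        rw [hv.weight, map_smul, h.mul_eq_one, one_smul] at this
        rw [← this, eq_neg_of_add_eq_zero_right (hL i)]
      raise := fun i j hij => by
        have := hSE i j
        rw [hv.raise _ _ hij, map_zero] at this
        exact (smul_eq_zero.1 this.symm).resolve_left (mul_ne_zero (h.ne_zero _) (h.ne_zero _)) }
  refine IsSelfDual.of_conj (hg := h.even) (isSelfDual_of_isHighest hρ.conj hd hv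
    (hv'.isLowest h.invol hd hρ.conj hc fun i hi => ?_))
  have := hL i
  rw [hi] at this
  simpa using this

/-! ### Existence of highest weight vectors -/

/-- Commuting operators on a finite-dimensional space have a common eigenvector. -/
lemma exists_common_eigenvector [FiniteDimensional ℂ V] {ι : Type*} (f : ι → Module.End ℂ V)
    (hf : ∀ i j, Commute (f i) (f j)) (S : Finset ι) (X : Submodule ℂ V) (hX : X ≠ ⊥)
    (hfX : ∀ i, ∀ w ∈ X, f i w ∈ X) : ∃ v ∈ X, v ≠ 0 ∧ ∀ i ∈ S, ∃ c : ℂ, f i v = c • v := by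
  classical
  induction S using Finset.induction_on generalizing X with
  | empty =>
    obtain ⟨v, hv, hv0⟩ := X.ne_bot_iff.1 hX
    exact ⟨v, hv, hv0, by simp⟩
  | insert i S _ ih =>
    have : Nontrivial X := Submodule.nontrivial_iff_ne_bot.2 hX
    obtain ⟨c, hc⟩ := Module.End.exists_eigenvalue ((f i).restrict (hfX i))
    obtain ⟨w, hw, hw0⟩ := hc.exists_hasEigenvector
    have hwc : f i w = c • (w : V) := by
      have := Module.End.mem_eigenspace_iff.1 hw
      simpa using congrArg Subtype.val this
    obtain ⟨v, ⟨hvX, hvc⟩, hv0, hv⟩ := ih (X ⊓ (f i).eigenspace c)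
      (Submodule.ne_bot_iff _ |>.2 ⟨w, ⟨w.2, Module.End.mem_eigenspace_iff.2 hwc⟩, by
        simpa using hw0⟩) (by
        rintro j u ⟨hu, huc⟩
        refine ⟨hfX j u hu, ?_⟩
        rw [SetLike.mem_coe, Module.End.mem_eigenspace_iff] at *
        have := LinearMap.congr_fun (hf i j).eq u
        simp only [Module.End.mul_apply] at this
        rw [this, huc, map_smul])
    refine ⟨v, hvX, hv0, fun j hj => ?_⟩
    rcases Finset.mem_insert.1 hj with rfl | hj
    · exact ⟨c, Module.End.mem_eigenspace_iff.1 hvc⟩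
    · exact hv j hj

/-- Finite-dimensional representations have highest weight vectors. -/
lemma exists_isHighest [FiniteDimensional ℂ V] [Nontrivial V] (ρ : Rep p q r s V)
    (d : Idx p q r s → ℤ) : ∃ L ε v, ρ.IsHighest d L ε v := by
  set u : Idx p q r s → ℂ := fun i => d i with hu
  set D := ρ.act (Matrix.diagonal u) with hD
  -- Matrix units of positive roots raise the eigenvalue by a positive integer, so they kill the
  -- eigenspace of maximal real part. Including the parity operator among the commuting operators
  -- makes the eigenvector homogeneous.
  obtain ⟨c, hc, hmax⟩ := Set.exists_max_image {c : ℂ | D.HasEigenvalue c} Complex.re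
    D.finite_hasEigenvalue (Module.End.exists_eigenvalue D)
  let f : Option (Idx p q r s) → Module.End ℂ V := fun o =>
    o.elim ρ.parityOp fun i => ρ.act (matUnit i i)
  have c1 : ∀ i, Commute (ρ.act (matUnit i i)) ρ.parityOp := fun i => by
    ext w
    have := ρ.parityOp_act (matUnit_self_mem i) w
    simpa [sgn] using this.symm
  have c2 : ∀ i j, Commute (ρ.act (matUnit i i)) (ρ.act (matUnit j j)) := fun i j => by
    ext w
    simpa using ρ.act_matUnit_self_matUnit i j j w
  have hf : ∀ i j, Commute (f i) (f j) := by
    rintro (_ | i) (_ | j)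
    exacts [Commute.refl _, (c1 j).symm, c1 i, c2 i j]
  obtain ⟨v, hv, hv0, hve⟩ := exists_common_eigenvector f hf Finset.univ (D.eigenspace c) hc (by
    rintro (_ | i) w hw
    · exact ρ.parityOp_mem_eigenspace hw
    · have := ρ.act_matUnit_mem_eigenspace hw i i
      rwa [sub_self, add_zero] at this)
  choose b hb using fun o => hve o (Finset.mem_univ o)
  refine ⟨fun i => b (some i), b none, v, hv0, hb none, fun i => hb (some i), fun i j hij => ?_⟩
  by_contra hne
  have h1 := ρ.act_matUnit_mem_eigenspace hv i j
  have h2 : D.HasEigenvalue (c + (u i - u j)) :=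
    Module.End.hasEigenvalue_of_hasEigenvector ⟨h1, hne⟩
  have h3 := hmax _ h2
  have h4 : (d j : ℝ) < d i := by exact_mod_cast hij
  simp only [hu, Complex.add_re, Complex.sub_re, Complex.intCast_re] at h3
  linarith

/-! ### Spherical representations -/

/-- Invariant and highest weight vectors are not assumed homogeneous. With `P` the parity operator,
`v + P v` and `v - P v` are eigenvectors of `P`, and they cannot both vanish. -/
lemma exists_parity_eigenvector (ρ : Rep p q r s V) {v : V} (hv : v ≠ 0) :
    ∃ (c ε : ℂ), v + c • ρ.parityOp v ≠ 0 ∧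
      ρ.parityOp (v + c • ρ.parityOp v) = ε • (v + c • ρ.parityOp v) := by
  by_cases h : v + (1 : ℂ) • ρ.parityOp v = 0
  · refine ⟨-1, -1, fun h' => hv ?_, ?_⟩
    · have : (2 : ℂ) • v = 0 := by
        have e : (2 : ℂ) • v =
            (v + (1 : ℂ) • ρ.parityOp v) + (v + (-1 : ℂ) • ρ.parityOp v) := by module
        rw [e, h, h', add_zero]
      simpa using this
    · rw [map_add, map_smul, parityOp_parityOp]
      module
  · refine ⟨1, 1, h, ?_⟩
    rw [map_add, map_smul, parityOp_parityOp]
    module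

/-- The highest weight of a spherical representation vanishes on `𝔥 ∩ 𝔨`. -/
lemma weight_add_eq_zero {ρ : Rep p q r s V} (hρ : ρ.IsIrreducible) (hs : ρ.IsSpherical)
    {g : (Mat p q r s)ˣ} {π : Idx p q r s → Idx p q r s} {t : Idx p q r s → ℂ}
    (h : IsAdapted g π t) (ht : ∀ i j, π i = i → π j = j → t i = t j)
    {d : Idx p q r s → ℤ} (hd : Function.Injective d)
    (hc : ∀ i j, (π i ≠ i ∨ π j ≠ j) → d j < d i → d (π i) < d (π j))
    {L : Idx p q r s → ℂ} {ε : ℂ} {v : V} (hv : (ρ.conj g h.even).IsHighest d L ε v)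
    (i : Idx p q r s) : L i + L (π i) = 0 := by
  obtain ⟨μ, hμv, h1, h2, -⟩ := hv.exists_functional hρ.conj hd
  obtain ⟨v₀, hv₀, hk⟩ := hs
  obtain ⟨a, η, hw0, hη⟩ := ρ.exists_parity_eigenvector hv₀
  set w := v₀ + a • ρ.parityOp v₀ with hw
  let A : Set (Mat p q r s) := {x | (∃ i, x ∈ homog p q r s i) ∧ conjMap g x ∈ kPart p q r s}
  let B : Set (Mat p q r s) := {x | ∃ i j, d i ≤ d j ∧ x = matUnit i j}
  have hAw : ∀ x ∈ A, (ρ.conj g h.even).act x w = 0 := by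
    rintro x ⟨⟨i, hi⟩, hx⟩
    have h0 := hk _ hx
    have h1 := ρ.parityOp_act (conjMap_mem h.even hi) v₀
    rw [h0, map_zero] at h1
    have h2 := (smul_eq_zero.1 h1.symm).resolve_left (sgn_self_ne_zero i)
    rw [conj_act, hw, map_add, map_smul, h0, h2, smul_zero, add_zero]
  have subA : ∀ x ∈ A, x ∈ Submodule.span ℂ (A ∪ B) :=
    fun x hx => Submodule.subset_span (Or.inl hx)
  have subB : ∀ x ∈ B, x ∈ Submodule.span ℂ (A ∪ B) :=
    fun x hx => Submodule.subset_span (Or.inr hx)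
  -- The Iwasawa-type decomposition. A positive root vector plus its image under `θ` lies in `𝔨`,
  -- and the image is a negative root vector unless both indices are fixed. In that case the equal
  -- coefficients make the root vector itself `θ`-fixed.
  have hspan : Submodule.span ℂ (A ∪ B) = ⊤ := by
    refine span_eq_top_of_matUnit_mem _ fun i j => ?_
    by_cases hij : d i ≤ d j
    · exact subB _ ⟨i, j, hij, rfl⟩
    have hA : matUnit i j + (t (π i) * t j) • matUnit (π i) (π j) ∈ A := by
      have hθ : conjMap g (matUnit i j + (t (π i) * t j) • matUnit (π i) (π j)) =
          conjMap g (matUnit i j) + theta (conjMap g (matUnit i j)) := by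
        rw [map_add, map_smul, h.theta_conjMap_matUnit]
      refine ⟨⟨parity i + parity j, ?_⟩, ?_⟩
      · have hm := conjMap_mem h.even (matUnit_mem i j)
        have := conjMap_mem (g := g⁻¹) (inv_mem_homog h.even)
          (Submodule.add_mem _ hm (theta_mem hm))
        rwa [← hθ, conjMap_inv_conjMap] at this
      · rw [hθ, mem_kPart, theta_add, theta_theta, add_comm]
    by_cases hf : π i ≠ i ∨ π j ≠ j
    · have hB : matUnit (π i) (π j) ∈ B := ⟨_, _, (hc i j hf (not_le.1 hij)).le, rfl⟩
      have := Submodule.sub_mem _ (subA _ hA)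
        (Submodule.smul_mem _ (t (π i) * t j) (subB _ hB))
      rwa [add_sub_cancel_right] at this
    · push Not at hf
      have ht1 : t (π i) * t j = 1 := by
        rw [← ht i j hf.1 hf.2, mul_comm, h.mul_eq_one]
      rw [ht1, hf.1, hf.2, one_smul, ← two_smul ℂ] at hA
      have := Submodule.smul_mem _ (2⁻¹ : ℂ) (subA _ hA)
      rwa [smul_smul, inv_mul_cancel₀ two_ne_zero, one_smul] at this
  -- The kernel of `μ` is stable under the opposite Borel subalgebra, which generates everything
  -- from the `𝔨`-invariant `w`.
  have hμw : μ w ≠ 0 := by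
    intro h0
    have hker : LinearMap.ker μ = ⊤ := by
      refine hρ.conj.eq_top_of_stable (ρ := ρ.conj g h.even) (A := A) (B := B) (fun x hx => hx.1)
        ?_ hspan hw0 hη
        (fun x hx => ⟨0, by rw [hAw x hx, zero_smul]⟩) (LinearMap.mem_ker.2 h0) ?_
      · rintro _ ⟨i, j, -, rfl⟩
        exact ⟨_, matUnit_mem i j⟩
      · rintro _ ⟨i, j, hij, rfl⟩ u hu
        rw [LinearMap.mem_ker] at *
        rcases hij.eq_or_lt with hij | hij
        · rw [hd hij, h2, hu, mul_zero]
        · exact h1 i j hij u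
    rw [LinearMap.ker_eq_top] at hker
    simp [hker] at hμv
  have h0 := hAw _ ⟨⟨0, Submodule.add_mem _ (matUnit_self_mem i) (matUnit_self_mem (π i))⟩,
    h.conjMap_add_mem_kPart i⟩
  have h3 := congrArg μ h0
  rw [map_add (ρ.conj g h.even).act, LinearMap.add_apply, map_add, h2, h2, map_zero,
    ← add_mul] at h3
  exact (mul_eq_zero.1 h3).resolve_right hμw

end Rep

/-! ### Toral subspaces -/

/-- Conjugation as an algebra homomorphism. -/
def conjAlgHom (g : (Mat p q r s)ˣ) : Mat p q r s →ₐ[ℂ] Mat p q r s :=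
  AlgHom.ofLinearMap (conjMap g) (by simp [conjMap_apply]) (conjMap_mul g)

/-- The product of `X - c` over the distinct diagonal entries `c` is squarefree and annihilates the
matrix. -/
lemma isSemisimple_conjMap_diagonal (g : (Mat p q r s)ˣ) (u : Idx p q r s → ℂ) :
    Module.End.IsSemisimple (Matrix.toLin' (conjMap g (Matrix.diagonal u))) := by
  classical
  let φ : (Idx p q r s → ℂ) →ₐ[ℂ] Module.End ℂ (Idx p q r s → ℂ) :=
    (Matrix.toLinAlgEquiv' : Mat p q r s ≃ₐ[ℂ] _).toAlgHom.comp
      ((conjAlgHom g).comp (Matrix.diagonalAlgHom ℂ))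
  change Module.End.IsSemisimple (φ u)
  let P : Polynomial ℂ := ∏ c ∈ Finset.univ.image u, (Polynomial.X - Polynomial.C c)
  have hP : Squarefree P :=
    (Polynomial.separable_prod_X_sub_C_iff'.2 fun x _ y _ h => h).squarefree
  refine Module.End.isSemisimple_of_squarefree_aeval_eq_zero hP ?_
  rw [Polynomial.aeval_algHom_apply]
  have h : Polynomial.aeval u P = 0 := by
    funext i
    rw [Polynomial.aeval_fn_apply, map_prod]
    exact Finset.prod_eq_zero (Finset.mem_image_of_mem u (Finset.mem_univ i)) (by simp)
  rw [h, map_zero]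

/-- The diagonal matrices. -/
def diagSubmodule (p q r s : ℕ) : Submodule ℂ (Mat p q r s) :=
  LinearMap.range (Matrix.diagonalLinearMap (Idx p q r s) ℂ ℂ)

lemma sbracket_diagonal (u w : Idx p q r s → ℂ) :
    sbracket (Matrix.diagonal u : Mat p q r s) (Matrix.diagonal w) = 0 := by
  rw [sbracket_even_left (diagonal_mem u), Matrix.diagonal_mul_diagonal,
    Matrix.diagonal_mul_diagonal, sub_eq_zero]
  congr 1
  funext i
  ring

lemma isToral_of_le_conj {g : (Mat p q r s)ˣ} (hg : (g : Mat p q r s) ∈ homog p q r s 0)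
    {t : Submodule ℂ (Mat p q r s)} (ht : t ≤ (diagSubmodule p q r s).map (conjMap g)) :
    IsToral t := by
  refine ⟨fun x hx => ?_, fun x hx y hy => ?_, fun x hx => ?_⟩
  · obtain ⟨_, ⟨u, rfl⟩, rfl⟩ := ht hx
    exact conjMap_mem hg (diagonal_mem u)
  · obtain ⟨_, ⟨u, rfl⟩, rfl⟩ := ht hx
    obtain ⟨_, ⟨w, rfl⟩, rfl⟩ := ht hy
    rw [← conjMap_sbracket hg]
    exact (congrArg _ (sbracket_diagonal u w)).trans (map_zero _)
  · obtain ⟨_, ⟨u, rfl⟩, rfl⟩ := ht hx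
    exact isSemisimple_conjMap_diagonal g u

lemma twist_diagonal {g : (Mat p q r s)ˣ} {π : Idx p q r s → Idx p q r s} {t : Idx p q r s → ℂ}
    (h : IsAdapted g π t) (u : Idx p q r s → ℂ) :
    twist π t (Matrix.diagonal u) = Matrix.diagonal fun i => u (π i) := by
  ext i j
  simp only [twist, Matrix.of_apply, Matrix.diagonal_apply, h.invol.injective.eq_iff]
  split_ifs with hij
  · rw [hij, h.mul_eq_one, one_mul]
  · simp

lemma theta_conjMap_diagonal {g : (Mat p q r s)ˣ} {π : Idx p q r s → Idx p q r s}
    {t : Idx p q r s → ℂ} (h : IsAdapted g π t) (u : Idx p q r s → ℂ) :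
    theta (conjMap g (Matrix.diagonal u)) = conjMap g (Matrix.diagonal fun i => u (π i)) := by
  rw [h.theta_conjMap, twist_diagonal h]

lemma theta_mul (x y : Mat p q r s) : theta (x * y) = theta x * theta y := by
  simp only [theta_eq]
  calc sigma p q r s * (x * y) * sigma p q r s =
      sigma p q r s * x * 1 * y * sigma p q r s := by simp only [mul_assoc, mul_one]
    _ = _ := by rw [← sigma_mul_self]; simp only [mul_assoc]

/-- A form which is anti-invariant under the involution and separates a non-fixed index from all
other indices. -/
lemma exists_anti_invariant {π : Idx p q r s → Idx p q r s} (hπ : Function.Involutive π)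
    {i : Idx p q r s} (hi : π i ≠ i) : ∃ u : Idx p q r s → ℂ, (∀ k, u (π k) = -u k) ∧
      ∀ j, j ≠ i → u i ≠ u j := by
  refine ⟨fun k => if k = i then 1 else if k = π i then -1 else 0, fun k => ?_, fun j hj => ?_⟩
  · have e : π k = i ↔ k = π i :=
      ⟨fun e => by rw [← e, hπ], fun e => by rw [e, hπ]⟩
    have e' : π k = π i ↔ k = i := hπ.injective.eq_iff
    simp only [e, e']
    split_ifs with h1 h2
    · exact absurd (h1.symm.trans h2) hi
    · simp
    · simp
    · simp
  · simp only [if_true, if_neg hj]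
    split_ifs <;> norm_num

/-- The anti-invariant diagonal matrices form an even Cartan subspace. -/
lemma isEvenType_of_isAdapted {g : (Mat p q r s)ˣ} {π : Idx p q r s → Idx p q r s}
    {t : Idx p q r s → ℂ} (h : IsAdapted g π t) (ht : ∀ i j, π i = i → π j = j → t i = t j) :
    IsEvenType p q r s := by
  let D : Submodule ℂ (Mat p q r s) :=
    { carrier := {x | ∃ u : Idx p q r s → ℂ, (∀ i, u (π i) = -u i) ∧ Matrix.diagonal u = x}
      add_mem' := by
        rintro _ _ ⟨u, hu, rfl⟩ ⟨w, hw, rfl⟩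
        exact ⟨u + w, fun i => by simp [hu, hw, add_comm], (Matrix.diagonal_add _ _).symm⟩
      zero_mem' := ⟨0, by simp, Matrix.diagonal_zero⟩
      smul_mem' := by
        rintro c _ ⟨u, hu, rfl⟩
        exact ⟨c • u, fun i => by simp [hu], Matrix.diagonal_smul _ _⟩ }
  have hD : ∀ x ∈ D.map (conjMap g), theta x = -x := by
    rintro _ ⟨_, ⟨u, hu, rfl⟩, rfl⟩
    rw [theta_conjMap_diagonal h, ← map_neg, Matrix.diagonal_neg]
    congr 2
    funext i
    exact hu i
  have htor : IsToral (D.map (conjMap g)) := by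
    refine isToral_of_le_conj h.even (Submodule.map_mono ?_)
    rintro _ ⟨u, -, rfl⟩
    exact ⟨u, rfl⟩
  refine ⟨D.map (conjMap g), hD, htor, le_antisymm (sup_le hD (Submodule.span_le.2 ?_)) ?_⟩
  · rintro _ ⟨x, hx, y, hy, rfl⟩
    rw [SetLike.mem_coe, mem_pPart, sbracket_even_right (htor.1 hy), theta_sub, theta_mul,
      theta_mul, hD y hy, mem_kPart.1 hx]
    noncomm_ring
  set U := D.map (conjMap g) ⊔
    Submodule.span ℂ {z | ∃ x ∈ kPart p q r s, ∃ y ∈ D.map (conjMap g), z = sbracket x y} with hU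
  -- Each `x ∈ 𝔭` is half of `x - θ x`, so only the differences coming from matrix units have to be
  -- placed in `U`.
  let X : Submodule ℂ (Mat p q r s) :=
    { carrier := {y | conjMap g y - theta (conjMap g y) ∈ U}
      add_mem' := fun {y z} hy hz => by
        simp only [Set.mem_ofPred_eq] at *
        rw [map_add, theta_add, add_sub_add_comm]
        exact U.add_mem hy hz
      zero_mem' := by simp [theta_eq]
      smul_mem' := fun c y hy => by
        simp only [Set.mem_ofPred_eq] at *
        rw [map_smul, theta_smul, ← smul_sub]
        exact U.smul_mem c hy }
  have hX : X = ⊤ := by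
    refine span_eq_top_of_matUnit_mem X fun i j => ?_
    change conjMap g (matUnit i j) - theta (conjMap g (matUnit i j)) ∈ U
    by_cases hij : i = j
    · subst hij
      refine Submodule.mem_sup_left ⟨matUnit i i - matUnit (π i) (π i), ?_, ?_⟩
      · refine ⟨Pi.single i 1 - Pi.single (π i) 1, fun k => ?_, ?_⟩
        · simp only [Pi.sub_apply, Pi.single_apply, h.invol.injective.eq_iff]
          have e : π k = i ↔ k = π i :=
            ⟨fun e => by rw [← e, h.invol], fun e => by rw [e, h.invol]⟩
          simp [e]
        · rw [matUnit_self_eq_diagonal, matUnit_self_eq_diagonal, Matrix.diagonal_sub]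
          rfl
      · rw [h.theta_conjMap_matUnit, mul_comm, h.mul_eq_one, one_smul, map_sub]
    by_cases hf : π i = i ∧ π j = j
    · rw [h.theta_conjMap_matUnit, hf.1, hf.2, ← ht i j hf.1 hf.2]
      have := h.mul_eq_one i
      rw [hf.1] at this
      rw [this, one_smul, sub_self]
      exact U.zero_mem
    have hu : ∃ u : Idx p q r s → ℂ, (∀ k, u (π k) = -u k) ∧ u i ≠ u j := by
      by_cases hi : π i = i
      · obtain ⟨u, hu, hne⟩ := exists_anti_invariant h.invol fun hj => hf ⟨hi, hj⟩
        exact ⟨u, hu, (hne i hij).symm⟩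
      · obtain ⟨u, hu, hne⟩ := exists_anti_invariant h.invol hi
        exact ⟨u, hu, hne j (Ne.symm hij)⟩
    obtain ⟨u, hu, hne⟩ := hu
    have hk : conjMap g (matUnit i j) + theta (conjMap g (matUnit i j)) ∈ kPart p q r s := by
      rw [mem_kPart, theta_add, theta_theta, add_comm]
    have hbr : ∀ k l, sbracket (conjMap g (matUnit k l)) (conjMap g (Matrix.diagonal u)) =
        (u l - u k) • conjMap g (matUnit k l) := fun k l => by
      have e := sbracket_diagonal_matUnit u k l
      rw [sbracket_even_left (diagonal_mem u)] at e
      rw [← conjMap_sbracket h.even, sbracket_even_right (diagonal_mem u), ← neg_sub, e,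
        ← neg_smul, neg_sub, map_smul]
    have hmem : sbracket (conjMap g (matUnit i j) + theta (conjMap g (matUnit i j)))
        (conjMap g (Matrix.diagonal u)) ∈ U :=
      Submodule.mem_sup_right (Submodule.subset_span ⟨_, hk, _, ⟨_, ⟨u, hu, rfl⟩, rfl⟩, rfl⟩)
    -- As `u` is anti-invariant, bracketing with it scales the matrix unit and its `θ`-image by
    -- opposite factors. The `θ`-invariant sum thus becomes the anti-invariant difference.
    have he : sbracket (conjMap g (matUnit i j) + theta (conjMap g (matUnit i j)))
        (conjMap g (Matrix.diagonal u)) =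
        (u j - u i) • (conjMap g (matUnit i j) - theta (conjMap g (matUnit i j))) := by
      have ev := conjMap_mem h.even (diagonal_mem u)
      have b1 := hbr i j
      have b2 := hbr (π i) (π j)
      rw [sbracket_even_right ev] at b1 b2 ⊢
      rw [add_mul, mul_add, add_sub_add_comm, b1, h.theta_conjMap_matUnit, smul_mul_assoc,
        mul_smul_comm, ← smul_sub, b2, hu, hu]
      module
    rw [he] at hmem
    have := U.smul_mem (u j - u i)⁻¹ hmem
    rwa [smul_smul, inv_mul_cancel₀ (sub_ne_zero.2 hne.symm), one_smul] at this
  intro x hx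
  have h1 : conjMap g⁻¹ x ∈ X := hX ▸ Submodule.mem_top
  change conjMap g (conjMap g⁻¹ x) - theta (conjMap g (conjMap g⁻¹ x)) ∈ U at h1
  rw [conjMap_conjMap_inv, mem_pPart.1 hx, sub_neg_eq_add, ← two_smul ℂ] at h1
  have := U.smul_mem (2⁻¹ : ℂ) h1
  rwa [smul_smul, inv_mul_cancel₀ two_ne_zero, one_smul] at this

/-! ### A standard adapted basis -/

/-- The involution that exchanges the first `min p q` indices of the two summands. -/
def swapPairs (p q : ℕ) : Fin p ⊕ Fin q → Fin p ⊕ Fin q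
  | Sum.inl i => if h : (i : ℕ) < q then Sum.inr ⟨i, h⟩ else Sum.inl i
  | Sum.inr j => if h : (j : ℕ) < p then Sum.inl ⟨j, h⟩ else Sum.inr j

/-- The standard involution of the index set. -/
def stdInvol : Idx p q r s → Idx p q r s := Sum.map (swapPairs p q) (swapPairs r s)

lemma swapPairs_invol (p q : ℕ) : Function.Involutive (swapPairs p q) := by
  rintro (i | i) <;> simp only [swapPairs] <;> split_ifs with h <;> simp [h]

lemma stdInvol_invol : Function.Involutive (stdInvol : Idx p q r s → Idx p q r s) := by
  rintro (i | i) <;> simp [stdInvol, swapPairs_invol _ _ i]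

lemma parity_stdInvol (i : Idx p q r s) : parity (stdInvol i) = parity i := by
  rcases i with i | i <;> rfl

lemma sigmaSign_stdInvol (i : Idx p q r s) (h : stdInvol i ≠ i) :
    sigmaSign (stdInvol i) = -sigmaSign i := by
  rcases i with (i | i) | (i | i) <;> simp only [stdInvol, swapPairs, Sum.map_inl, Sum.map_inr]
    at h ⊢ <;> split_ifs at h ⊢ with h' <;> simp_all [sigmaSign]

/-- Even fixed indices carry the sign of `p - q` and odd ones the sign of `r - s`. If both kinds
occur, the product of these differences is nonzero, and the hypothesis forces the signs to agree. -/
lemma sigmaSign_eq_of_fixed (hpqrs : 0 ≤ ((p : ℤ) - (q : ℤ)) * ((r : ℤ) - (s : ℤ)))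
    (i j : Idx p q r s) (hi : stdInvol i = i) (hj : stdInvol j = j) :
    sigmaSign i = sigmaSign j := by
  have key : (q < p → r < s → False) ∧ (p < q → s < r → False) := by
    constructor <;> intro h1 h2 <;> nlinarith
  have f : ∀ i : Idx p q r s, stdInvol i = i → (sigmaSign i = 1 ∧ (q < p ∨ s < r)) ∨
      (sigmaSign i = -1 ∧ (p < q ∨ r < s)) := by
    rintro ((i | i) | (i | i)) h <;>
      simp only [stdInvol, swapPairs, Sum.map_inl, Sum.map_inr] at h <;>
      split_ifs at h with h' <;> simp [sigmaSign] at h ⊢ <;> omega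
  rcases f i hi with ⟨hi, hi' | hi'⟩ | ⟨hi, hi' | hi'⟩ <;>
    rcases f j hj with ⟨hj, hj' | hj'⟩ | ⟨hj, hj' | hj'⟩ <;>
    first
    | exact hi.trans hj.symm
    | exact absurd hi' hj'.not_gt
    | exact (key.1 hi' hj').elim
    | exact (key.1 hj' hi').elim
    | exact (key.2 hi' hj').elim
    | exact (key.2 hj' hi').elim

/-- The entries of the monomial matrix of `σ` in the standard adapted basis. -/
def stdCoeff (i : Idx p q r s) : ℂ := if stdInvol i = i then sigmaSign i else 1

lemma stdCoeff_mul (i : Idx p q r s) : stdCoeff i * stdCoeff (stdInvol i) = 1 := by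
  by_cases h : stdInvol i = i
  · rw [h, stdCoeff, if_pos h, sigmaSign_mul_self]
  · rw [stdCoeff, stdCoeff, if_neg h, if_neg fun e => h (stdInvol_invol.injective e), one_mul]

lemma monomial_mem {π : Idx p q r s → Idx p q r s} (hπ : ∀ i, parity (π i) = parity i)
    (t : Idx p q r s → ℂ) : monomial π t ∈ homog p q r s 0 := by
  intro a b hab
  rw [monomial, Matrix.of_apply, if_neg]
  rintro rfl
  exact hab (by rw [hπ, parity_add_self])

lemma monomial_mul_self {π : Idx p q r s → Idx p q r s} (hπ : Function.Involutive π)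
    {t : Idx p q r s → ℂ} (ht : ∀ i, t i * t (π i) = 1) :
    monomial π t * monomial π t = 1 := by
  ext i j
  rw [Matrix.mul_apply, Finset.sum_eq_single (π i)]
  · simp only [monomial, Matrix.of_apply, if_true, hπ i, Matrix.one_apply, @eq_comm _ j i]
    split_ifs
    · exact ht i
    · rw [mul_zero]
  · intro b _ hb
    simp [monomial, hb]
  · simp

/-- For two involutive matrices `σ` and `τ`, the sum `σ + τ` intertwines them: `σ (σ + τ) = 1 + σ τ
= (σ + τ) τ`. -/
lemma exists_isAdapted : ∃ g : (Mat p q r s)ˣ, IsAdapted g stdInvol stdCoeff := by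
  set τ : Mat p q r s := monomial stdInvol stdCoeff with hτ
  have hττ : τ * τ = 1 := monomial_mul_self stdInvol_invol stdCoeff_mul
  -- On a swapped pair `σ` and `τ` anticommute, so the square of the sum is `2`; on a fixed index
  -- they agree, so it is `4`.
  let e : Idx p q r s → ℂ := fun i => if stdInvol i = i then 4 else 2
  have he : ∀ i, e i ≠ 0 := fun i => by
    simp only [e]
    split_ifs <;> norm_num
  have hG : (sigma p q r s + τ) * (sigma p q r s + τ) = Matrix.diagonal e := by
    rw [add_mul, mul_add, mul_add, sigma_mul_self, hττ]
    ext i j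
    simp only [Matrix.add_apply, sigma_eq, Matrix.diagonal_mul, Matrix.mul_diagonal,
      Matrix.one_apply, Matrix.diagonal_apply, hτ, monomial, Matrix.of_apply, e, stdCoeff]
    by_cases h : stdInvol i = i
    · rw [h]
      by_cases hij : i = j
      · subst hij
        simp only [if_true]
        linear_combination 2 * sigmaSign_mul_self i
      · simp [hij, Ne.symm hij]
    · have h1 := sigmaSign_stdInvol i h
      by_cases hj : j = stdInvol i
      · subst hj
        simp [h, Ne.symm h, h1]
      · by_cases hij : i = j
        · subst hij
          simp [h, hj]
          norm_num
        · simp [hj, hij]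
  have hG' : (sigma p q r s + τ) * ((sigma p q r s + τ) * Matrix.diagonal fun i => (e i)⁻¹) = 1 := by
    rw [← mul_assoc, hG, Matrix.diagonal_mul_diagonal, ← Matrix.diagonal_one]
    congr 1
    funext i
    exact mul_inv_cancel₀ (he i)
  refine ⟨⟨_, _, hG', mul_eq_one_comm.1 hG'⟩, ?_, stdInvol_invol, stdCoeff_mul, ?_⟩
  · exact Submodule.add_mem _ (diagonal_mem _) (monomial_mem parity_stdInvol _)
  · change sigma p q r s * (sigma p q r s + τ) = (sigma p q r s + τ) * τ
    rw [mul_add, add_mul, sigma_mul_self, hττ, add_comm]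

lemma sigmaSign_eq (i : Idx p q r s) : sigmaSign i = 1 ∨ sigmaSign i = -1 := by
  rcases i with (i | i) | (i | i) <;> simp [sigmaSign]

/-- There is an order of the index set which the standard involution reverses, except on its fixed
points. -/
lemma exists_order : ∃ d : Idx p q r s → ℤ, Function.Injective d ∧ ∀ i j,
    (stdInvol i ≠ i ∨ stdInvol j ≠ j) → d j < d i → d (stdInvol i) < d (stdInvol j) := by
  classical
  let e := Fintype.equivFin (Idx p q r s)
  set N : ℤ := ((Fintype.card (Idx p q r s) : ℕ) : ℤ) with hN
  have e0 : ∀ i, (0 : ℤ) ≤ (e i : ℕ) ∧ ((e i : ℕ) : ℤ) < N := fun i =>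
    ⟨by positivity, by rw [hN]; exact Int.ofNat_lt.2 (e i).2⟩
  have einj : ∀ i j, ((e i : ℕ) : ℤ) = (e j : ℕ) → i = j := fun i j h =>
    e.injective (Fin.ext (by exact_mod_cast h))
  -- Fixed indices occupy `[0, N)`. A swapped index of sign `1` is placed at height at least `N` and
  -- its partner at the opposite height, so that `π` acts as negation on the non-fixed heights.
  let d : Idx p q r s → ℤ := fun i => if stdInvol i = i then (e i : ℕ) else
    if sigmaSign i = 1 then N + (e i : ℕ) else -(N + (e (stdInvol i) : ℕ))
  have d1 : ∀ i, stdInvol i = i → d i = (e i : ℕ) := fun i h => if_pos h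
  have d2 : ∀ i, stdInvol i ≠ i → (d i = N + (e i : ℕ) ∧ d (stdInvol i) = -(N + (e i : ℕ))) ∨
      (d i = -(N + (e (stdInvol i) : ℕ)) ∧ d (stdInvol i) = N + (e (stdInvol i) : ℕ)) := by
    intro i h
    have h' : stdInvol (stdInvol i) ≠ stdInvol i := fun e => h (stdInvol_invol.injective e)
    have h1 := sigmaSign_stdInvol i h
    have h2 : (-1 : ℂ) ≠ 1 := by norm_num
    rcases sigmaSign_eq i with hs | hs <;> rw [hs] at h1
    · left
      simp only [d, if_neg h, if_neg h', hs, h1, stdInvol_invol i, if_true, if_neg h2, and_self]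
    · right
      simp only [d, if_neg h, if_neg h', hs, h1, neg_neg, if_true, if_neg h2, and_self]
  refine ⟨d, fun i j hij => ?_, fun i j h hij => ?_⟩
  · have a1 := e0 i
    have a2 := e0 j
    have a3 := e0 (stdInvol i)
    have a4 := e0 (stdInvol j)
    by_cases hi : stdInvol i = i <;> by_cases hj : stdInvol j = j
    · exact einj i j (by rw [← d1 i hi, ← d1 j hj, hij])
    · have := d1 i hi
      rcases d2 j hj with h | h <;> omega
    · have := d1 j hj
      rcases d2 i hi with h | h <;> omega
    · rcases d2 i hi with h | h <;> rcases d2 j hj with h' | h'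
      · exact einj i j (by omega)
      · omega
      · omega
      · exact stdInvol_invol.injective (einj _ _ (by omega))
  · have a1 := e0 i
    have a2 := e0 j
    have a3 := e0 (stdInvol i)
    have a4 := e0 (stdInvol j)
    by_cases hi : stdInvol i = i <;> by_cases hj : stdInvol j = j
    · exact absurd h (by simp [hi, hj])
    · have := d1 i hi
      rw [hi]
      rcases d2 j hj with h | h <;> omega
    · have := d1 j hj
      rw [hj]
      rcases d2 i hi with h | h <;> omega
    · rcases d2 i hi with h | h <;> rcases d2 j hj with h' | h' <;> omega

/-! ### Even type and spherical self-duality -/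

lemma stdCoeff_eq_of_fixed (hpqrs : 0 ≤ ((p : ℤ) - (q : ℤ)) * ((r : ℤ) - (s : ℤ)))
    (i j : Idx p q r s) (hi : stdInvol i = i) (hj : stdInvol j = j) :
    stdCoeff i = stdCoeff j := by
  rw [stdCoeff, stdCoeff, if_pos hi, if_pos hj, sigmaSign_eq_of_fixed hpqrs i j hi hj]

/-- The symmetric superpair is of even type. -/
theorem isEvenType (hpqrs : 0 ≤ ((p : ℤ) - (q : ℤ)) * ((r : ℤ) - (s : ℤ))) :
    IsEvenType p q r s := by
  obtain ⟨g, hg⟩ := exists_isAdapted (p := p) (q := q) (r := r) (s := s)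
  exact isEvenType_of_isAdapted hg (stdCoeff_eq_of_fixed hpqrs)

/-- Irreducible spherical representations are self-dual. -/
theorem Rep.IsSpherical.isSelfDual (hpqrs : 0 ≤ ((p : ℤ) - (q : ℤ)) * ((r : ℤ) - (s : ℤ)))
    {V : Type*} [AddCommGroup V] [Module ℂ V] [FiniteDimensional ℂ V] {ρ : Rep p q r s V}
    (hρ : ρ.IsIrreducible) (hs : ρ.IsSpherical) : ρ.IsSelfDual := by
  obtain ⟨g, hg⟩ := exists_isAdapted (p := p) (q := q) (r := r) (s := s)
  obtain ⟨d, hd, hc⟩ := exists_order (p := p) (q := q) (r := r) (s := s)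
  have := hρ.1
  obtain ⟨L, ε, v, hv⟩ := (ρ.conj g hg.even).exists_isHighest d
  exact Rep.isSelfDual_of_isAdapted hρ hg hd hc
    (Rep.weight_add_eq_zero hρ hs hg (stdCoeff_eq_of_fixed hpqrs) hd hc hv) hv

/-! ### Cartan subalgebras -/

lemma exists_basis_of_span_eq_top {κ : Type*} [Fintype κ] (E : Set (κ → ℂ))
    (hE : Submodule.span ℂ E = ⊤) : ∃ b : Module.Basis κ ℂ (κ → ℂ), ∀ k, b k ∈ E := by
  let b := Module.Basis.ofSpan hE.ge
  refine ⟨b.reindex (b.indexEquiv (Pi.basisFun ℂ κ)), fun k => ?_⟩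
  rw [Module.Basis.reindex_apply]
  exact Module.Basis.ofSpan_subset hE.ge ⟨_, rfl⟩

/-- The blocks of a toral subspace are simultaneously diagonalizable. -/
lemma IsToral.exists_basis {h : Submodule ℂ (Mat p q r s)} (hh : IsToral h) {κ : Type*} [Fintype κ]
    (f : κ → Idx p q r s) (hf : Function.Injective f)
    (hfh : ∀ x ∈ h, ∀ i, ∀ j ∉ Set.range f, x (f i) j = 0) :
    ∃ b : Module.Basis κ ℂ (κ → ℂ), ∀ k, ∀ x ∈ h, ∃ c : ℂ,
      (x.submatrix f f).mulVec (b k) = c • b k := by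
  refine exists_basis_of_span_eq_top {w | ∀ x ∈ h, ∃ c : ℂ, (x.submatrix f f).mulVec w = c • w} ?_
  let F : h → Module.End ℂ (Idx p q r s → ℂ) := fun x => Matrix.toLin' (x : Mat p q r s)
  have hcomm : Pairwise (Function.onFun Commute F) := by
    intro x y _
    have := hh.2.1 x x.2 y y.2
    rw [sbracket_even_left (hh.1 x.2), sub_eq_zero] at this
    change F x ∘ₗ F y = F y ∘ₗ F x
    rw [← Matrix.toLin'_mul, ← Matrix.toLin'_mul, this]
  have hss : ∀ x, (F x).IsSemisimple := fun x => hh.2.2 x x.2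
  have htop := Module.End.iSup_iInf_maxGenEigenspace_eq_top_of_iSup_maxGenEigenspace_eq_top_of_commute
    F hcomm fun x => by
      simpa only [(hss x).isFinitelySemisimple.maxGenEigenspace_eq_eigenspace] using
        (hss x).iSup_eigenspace_eq_top
  simp only [fun x => (hss x).isFinitelySemisimple.maxGenEigenspace_eq_eigenspace] at htop
  -- Joint eigenvectors span the whole space. Since the rows of the block vanish outside it,
  -- restricting coordinates to the block sends them to zero or to joint eigenvectors of the block,
  -- and these span because restriction is surjective.
  let R : (Idx p q r s → ℂ) →ₗ[ℂ] (κ → ℂ) := LinearMap.funLeft ℂ ℂ f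
  have hR : LinearMap.range R = ⊤ :=
    LinearMap.range_eq_top.2 (LinearMap.funLeft_surjective_of_injective ℂ ℂ f hf)
  rw [eq_top_iff, ← hR, LinearMap.range_eq_map, ← htop, Submodule.map_iSup]
  refine iSup_le fun χ => ?_
  rintro _ ⟨v, hv, rfl⟩
  refine Submodule.subset_span fun x hx => ⟨χ ⟨x, hx⟩, ?_⟩
  have hv' := Module.End.mem_eigenspace_iff.1 ((Submodule.mem_iInf _).1 hv ⟨x, hx⟩)
  funext k
  have hk := congrFun hv' (f k)
  simp only [F, Matrix.toLin'_apply, Matrix.mulVec, dotProduct, Pi.smul_apply] at hk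
  simp only [Matrix.mulVec, dotProduct, R, LinearMap.funLeft_apply, Matrix.submatrix_apply,
    Pi.smul_apply]
  rw [← hk]
  classical
  rw [← Finset.sum_image (s := Finset.univ) (g := f) (f := fun j => x (f k) j * v j)
    (fun a _ b _ e => hf e)]
  refine Finset.sum_subset (Finset.subset_univ _) fun j _ hj => ?_
  rw [hfh x hx k j fun ⟨a, ha⟩ => hj (Finset.mem_image.2 ⟨a, Finset.mem_univ a, ha⟩), zero_mul]

/-- Toral subspaces are simultaneously diagonalizable in a homogeneous basis. -/
lemma IsToral.exists_le_conj {h : Submodule ℂ (Mat p q r s)} (hh : IsToral h) :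
    ∃ g : (Mat p q r s)ˣ, (g : Mat p q r s) ∈ homog p q r s 0 ∧
      h ≤ (diagSubmodule p q r s).map (conjMap g) := by
  have z1 : ∀ x ∈ h, ∀ i j, x (Sum.inl i) (Sum.inr j) = 0 := fun x hx i j =>
    hh.1 hx _ _ (by simp [parity])
  have z2 : ∀ x ∈ h, ∀ i j, x (Sum.inr i) (Sum.inl j) = 0 := fun x hx i j =>
    hh.1 hx _ _ (by simp [parity])
  obtain ⟨b, hb⟩ := hh.exists_basis (κ := Fin p ⊕ Fin q) Sum.inl Sum.inl_injective (by
    rintro x hx i (j | j) hj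
    · exact absurd ⟨j, rfl⟩ hj
    · exact z1 x hx i j)
  obtain ⟨b', hb'⟩ := hh.exists_basis (κ := Fin r ⊕ Fin s) Sum.inr Sum.inr_injective (by
    rintro x hx i (j | j) hj
    · exact z2 x hx i j
    · exact absurd ⟨j, rfl⟩ hj)
  set G := (Pi.basisFun ℂ (Fin p ⊕ Fin q)).toMatrix b with hG
  set G' := (Pi.basisFun ℂ (Fin r ⊕ Fin s)).toMatrix b' with hG'
  have e1 : G * b.toMatrix (Pi.basisFun ℂ (Fin p ⊕ Fin q)) = 1 :=
    Module.Basis.toMatrix_mul_toMatrix_flip _ _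
  have e2 : G' * b'.toMatrix (Pi.basisFun ℂ (Fin r ⊕ Fin s)) = 1 :=
    Module.Basis.toMatrix_mul_toMatrix_flip _ _
  have hinv : (Matrix.fromBlocks G 0 0 G' : Mat p q r s) *
      Matrix.fromBlocks (b.toMatrix (Pi.basisFun ℂ _)) 0 0 (b'.toMatrix (Pi.basisFun ℂ _)) = 1 := by
    rw [Matrix.fromBlocks_multiply]
    simp [e1, e2]
  let g : (Mat p q r s)ˣ := ⟨_, _, hinv, mul_eq_one_comm.1 hinv⟩
  refine ⟨g, ?_, fun x hx => ?_⟩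
  · rintro (i | i) (j | j) hij
    · simp [parity] at hij
    · rfl
    · rfl
    · exact absurd (by simp [parity]; decide) hij
  choose c hc using fun k => hb k x hx
  choose c' hc' using fun k => hb' k x hx
  have h1 : x * (g : Mat p q r s) = g * Matrix.diagonal (Sum.elim c c') := by
    have hx' : x = Matrix.fromBlocks (x.submatrix Sum.inl Sum.inl) 0 0
        (x.submatrix Sum.inr Sum.inr) := by
      ext (i | i) (j | j)
      · rfl
      · exact z1 x hx i j
      · exact z2 x hx i j
      · rfl
    have d1 : x.submatrix Sum.inl Sum.inl * G = G * Matrix.diagonal c := by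
      ext i j
      have := congrFun (hc j) i
      rw [Matrix.mul_diagonal]
      simpa [Matrix.mul_apply, Matrix.mulVec, dotProduct, hG, Module.Basis.toMatrix_apply,
        mul_comm] using this
    have d2 : x.submatrix Sum.inr Sum.inr * G' = G' * Matrix.diagonal c' := by
      ext i j
      have := congrFun (hc' j) i
      rw [Matrix.mul_diagonal]
      simpa [Matrix.mul_apply, Matrix.mulVec, dotProduct, hG', Module.Basis.toMatrix_apply,
        mul_comm] using this
    rw [← Matrix.fromBlocks_diagonal]
    conv_lhs => rw [hx']
    change Matrix.fromBlocks _ _ _ _ * Matrix.fromBlocks _ _ _ _ =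
      Matrix.fromBlocks _ _ _ _ * Matrix.fromBlocks _ _ _ _
    rw [Matrix.fromBlocks_multiply, Matrix.fromBlocks_multiply]
    simp [d1, d2]
  refine ⟨_, ⟨Sum.elim c c', rfl⟩, ?_⟩
  change conjMap g (Matrix.diagonal (Sum.elim c c')) = x
  rw [conjMap_apply, ← h1, mul_assoc, Units.mul_inv, mul_one]

/-- Cartan subalgebras are conjugate to the diagonal matrices. -/
lemma IsCartan.exists_eq_conj {h : Submodule ℂ (Mat p q r s)} (hh : IsCartan h) :
    ∃ g : (Mat p q r s)ˣ, (g : Mat p q r s) ∈ homog p q r s 0 ∧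
      h = (diagSubmodule p q r s).map (conjMap g) := by
  obtain ⟨g, hg, hle⟩ := hh.1.exists_le_conj
  exact ⟨g, hg, (hh.2 _ (isToral_of_le_conj hg le_rfl) hle).symm⟩

/-- If the Cartan subalgebra is `θ`-stable, then `σ` is monomial in the corresponding basis. -/
lemma exists_isAdapted_of_theta_stable {g : (Mat p q r s)ˣ}
    (hg : (g : Mat p q r s) ∈ homog p q r s 0)
    (hθ : ∀ x ∈ (diagSubmodule p q r s).map (conjMap g),
      theta x ∈ (diagSubmodule p q r s).map (conjMap g)) :
    ∃ π t, IsAdapted g π t := by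
  set τ : Mat p q r s := conjMap g⁻¹ (sigma p q r s) with hτ
  have hττ : τ * τ = 1 := by
    rw [hτ, ← conjMap_mul, sigma_mul_self]
    simp [conjMap_apply]
  let e := Fintype.equivFin (Idx p q r s)
  -- A diagonal matrix with distinct entries: its conjugate by `τ` is again diagonal, so each row of
  -- `τ` can be nonzero only in the column whose entry of `u` matches.
  let u : Idx p q r s → ℂ := fun i => ((e i : ℕ) : ℂ)
  have hu : Function.Injective u := fun i j hij =>
    e.injective (Fin.ext (Nat.cast_injective hij))
  obtain ⟨_, ⟨u', rfl⟩, hu'⟩ := hθ _ ⟨_, ⟨u, rfl⟩, rfl⟩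
  have hu'' : Matrix.diagonal u' * τ = τ * Matrix.diagonal u := by
    have h1 := congrArg (conjMap g⁻¹) hu'
    rw [conjMap_inv_conjMap, theta_eq, conjMap_mul, conjMap_mul, conjMap_inv_conjMap, ← hτ] at h1
    change Matrix.diagonal u' = τ * Matrix.diagonal u * τ at h1
    rw [h1, mul_assoc, hττ, mul_one]
  have hent : ∀ i j, τ i j ≠ 0 → u j = u' i := fun i j hij => by
    have := congrFun (congrFun hu'' i) j
    rw [Matrix.diagonal_mul, Matrix.mul_diagonal] at this
    have h2 : τ i j * (u j - u' i) = 0 := by linear_combination -this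
    exact sub_eq_zero.1 ((mul_eq_zero.1 h2).resolve_left hij)
  have hone : ∀ i, ∑ j, τ i j * τ j i = 1 := fun i => by
    rw [← Matrix.mul_apply, hττ, Matrix.one_apply_eq]
  have hex : ∀ i, ∃ j, τ i j ≠ 0 := fun i => by
    by_contra! h0
    have := hone i
    simp [h0] at this
  choose π hπ using hex
  have hz : ∀ i j, j ≠ π i → τ i j = 0 := fun i j hj => by
    by_contra h0
    exact hj (hu ((hent i j h0).trans (hent i _ (hπ i)).symm))
  have hone' : ∀ i, τ i (π i) * τ (π i) i = 1 := fun i => by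
    have h1 : ∑ j, τ i j * τ j i = τ i (π i) * τ (π i) i :=
      Finset.sum_eq_single (π i) (fun j _ hj => by rw [hz i j hj, zero_mul])
        fun h0 => absurd (Finset.mem_univ _) h0
    rw [← h1, hone i]
  have hinv : Function.Involutive π := fun i => by
    by_contra h0
    have := hone' i
    rw [hz (π i) i (Ne.symm h0), mul_zero] at this
    exact zero_ne_one this
  have hmon : τ = monomial π fun i => τ i (π i) := by
    ext i j
    rw [monomial, Matrix.of_apply]
    split_ifs with h
    · rw [h]
    · exact hz i j h
  refine ⟨π, fun i => τ i (π i), hg, hinv, fun i => ?_, ?_⟩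
  · rw [hinv i]
    exact hone' i
  · rw [← hmon, hτ, conjMap_apply]
    simp [← mul_assoc]

/-! ### Weights with respect to a Cartan subalgebra -/

/-- The linear form given by the `i`-th diagonal entry in the basis formed by the columns
of `g`. -/
def entryForm (h : Submodule ℂ (Mat p q r s)) (g : (Mat p q r s)ˣ) (i : Idx p q r s) :
    Module.Dual ℂ h where
  toFun u := conjMap g⁻¹ (u : Mat p q r s) i i
  map_add' u w := by simp
  map_smul' c u := by simp

lemma entryForm_apply {h : Submodule ℂ (Mat p q r s)} {g : (Mat p q r s)ˣ} (i : Idx p q r s)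
    (u : h) {w : Idx p q r s → ℂ} (hw : conjMap g (Matrix.diagonal w) = u) :
    entryForm h g i u = w i := by
  change conjMap g⁻¹ (u : Mat p q r s) i i = _
  rw [← hw, conjMap_inv_conjMap, Matrix.diagonal_apply_eq]

section Cartan

variable {h : Submodule ℂ (Mat p q r s)} {g : (Mat p q r s)ˣ}

lemma conjMap_matUnit_mem_rootSpace (hg : (g : Mat p q r s) ∈ homog p q r s 0)
    (hh : h = (diagSubmodule p q r s).map (conjMap g)) (i j : Idx p q r s) :
    conjMap g (matUnit i j) ∈ rootSpace h (entryForm h g i - entryForm h g j) := by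
  rintro ⟨u, hu⟩
  obtain ⟨_, ⟨w, rfl⟩, hw⟩ := hh ▸ hu
  change conjMap g (Matrix.diagonal w) = u at hw
  rw [LinearMap.sub_apply, entryForm_apply i _ hw, entryForm_apply j _ hw, ← map_smul,
    ← sbracket_diagonal_matUnit, conjMap_sbracket hg, hw]

lemma conjMap_matUnit_mem (hh : h = (diagSubmodule p q r s).map (conjMap g)) (i : Idx p q r s) :
    conjMap g (matUnit i i) ∈ h := by
  rw [hh, matUnit_self_eq_diagonal]
  exact ⟨_, ⟨_, rfl⟩, rfl⟩

lemma entryForm_sub_mem_roots (hg : (g : Mat p q r s) ∈ homog p q r s 0)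
    (hh : h = (diagSubmodule p q r s).map (conjMap g)) {i j : Idx p q r s} (hij : i ≠ j) :
    entryForm h g i - entryForm h g j ∈ roots h := by
  refine ⟨fun h0 => ?_, _, conjMap_matUnit_mem_rootSpace hg hh i j, fun h0 => ?_⟩
  · have := LinearMap.congr_fun h0 ⟨_, conjMap_matUnit_mem hh i⟩
    rw [LinearMap.sub_apply, entryForm_apply i _ (by rw [← matUnit_self_eq_diagonal]),
      entryForm_apply j _ (by rw [← matUnit_self_eq_diagonal])] at this
    simp [hij.symm] at this
  · rw [← map_zero (conjMap g)] at h0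
    have := congrFun (congrFun (conjMap_injective g h0) i) j
    simp [matUnit_apply] at this

/-- A positive system is given by an order of the index set. -/
lemma IsPositiveSystem.exists_order (hg : (g : Mat p q r s) ∈ homog p q r s 0)
    (hh : h = (diagSubmodule p q r s).map (conjMap g)) {P : Set (Module.Dual ℂ h)}
    (hP : IsPositiveSystem (roots h) P) : ∃ d : Idx p q r s → ℤ, Function.Injective d ∧
      ∀ i j, d j < d i → entryForm h g i - entryForm h g j ∈ P := by
  classical
  let R : Idx p q r s → Idx p q r s → Prop := fun i j => entryForm h g i - entryForm h g j ∈ P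
  have tot : ∀ i j, i ≠ j → R i j ∨ R j i := fun i j hij => by
    have := (hP.1 _).1 (entryForm_sub_mem_roots hg hh hij)
    rwa [neg_sub] at this
  have asymm : ∀ i j, R i j → ¬ R j i := fun i j hij => by
    have := hP.2.1 _ hij
    rwa [neg_sub] at this
  have trans : ∀ i j k, R i j → R j k → R i k := fun i j k h1 h2 => by
    have hik : i ≠ k := by
      rintro rfl
      exact asymm _ _ h1 h2
    have := hP.2.2 _ h1 _ h2
    rw [sub_add_sub_cancel] at this
    exact this (entryForm_sub_mem_roots hg hh hik)
  -- The positive roots define a strict total order on indices; the height of an index is the number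
  -- of indices below it.
  let d : Idx p q r s → ℤ := fun i => ((Finset.univ.filter fun j => R i j).card : ℤ)
  have lt : ∀ i j, R i j → d j < d i := fun i j hij => by
    have : (Finset.univ.filter fun k => R j k) ⊂ Finset.univ.filter fun k => R i k := by
      rw [Finset.ssubset_iff_of_subset]
      · exact ⟨j, by simpa using hij, by simpa using fun hjj => asymm j j hjj hjj⟩
      · intro k hk
        simp only [Finset.mem_filter, Finset.mem_univ, true_and] at *
        exact trans i j k hij hk
    simpa [d] using Finset.card_lt_card this
  refine ⟨d, fun i j hij => ?_, fun i j hij => ?_⟩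
  · by_contra hne
    rcases tot i j hne with h | h
    · exact (lt _ _ h).ne' hij
    · exact (lt _ _ h).ne hij
  · rcases tot i j (by rintro rfl; exact lt_irrefl _ hij) with h | h
    · exact h
    · exact absurd (lt _ _ h) hij.not_gt

variable {a : Submodule ℂ (Mat p q r s)}

/-- An even Cartan subspace is the `(-1)`-eigenspace of `θ` in every Cartan subalgebra that
contains it. -/
lemma IsEvenCartanSubspace.mem_of_mem_pPart (hg : (g : Mat p q r s) ∈ homog p q r s 0)
    (hh : h = (diagSubmodule p q r s).map (conjMap g)) (ha : IsEvenCartanSubspace a)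
    (hah : a ≤ h) {x : Mat p q r s} (hx : x ∈ h) (hxp : x ∈ pPart p q r s) : x ∈ a := by
  rw [← ha.2.2] at hxp
  obtain ⟨y, hy, z, hz, rfl⟩ := Submodule.mem_sup.1 hxp
  have hzh : z ∈ h := by simpa using h.sub_mem hx (hah hy)
  -- In the basis `g` the subspace `𝔞` is diagonal, so brackets with it have zero diagonal. The
  -- component of `x` in `[𝔨, 𝔞]` lies in `𝔥` and is therefore zero.
  let Z : Submodule ℂ (Mat p q r s) :=
    { carrier := {z | ∀ i, conjMap g⁻¹ z i i = 0}
      add_mem' := fun {b c} hb hc i => by simp [hb i, hc i]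
      zero_mem' := by simp
      smul_mem' := fun c b hb i => by simp [hb i] }
  have hZ : Submodule.span ℂ {z | ∃ x ∈ kPart p q r s, ∃ y ∈ a, z = sbracket x y} ≤ Z := by
    rw [Submodule.span_le]
    rintro _ ⟨b, -, c, hc, rfl⟩ i
    obtain ⟨_, ⟨w, rfl⟩, hw⟩ := hh ▸ hah hc
    change conjMap g (Matrix.diagonal w) = c at hw
    rw [conjMap_sbracket (inv_mem_homog hg), ← hw, conjMap_inv_conjMap,
      sbracket_even_right (diagonal_mem w), Matrix.sub_apply, Matrix.mul_diagonal,
      Matrix.diagonal_mul]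
    ring
  have hz0 : z = 0 := by
    obtain ⟨_, ⟨w, rfl⟩, hw⟩ := hh ▸ hzh
    change conjMap g (Matrix.diagonal w) = z at hw
    have h0 : w = 0 := by
      funext i
      have := hZ hz i
      rwa [← hw, conjMap_inv_conjMap, Matrix.diagonal_apply_eq] at this
    rw [← hw, h0, Matrix.diagonal_zero', map_zero]
  rwa [hz0, add_zero]

end Cartan

/-- Irreducible representations whose highest weight with respect to a compatible positive system
vanishes on `𝔥 ∩ 𝔨` are self-dual. -/
theorem Rep.HasHighestWeight.isSelfDual {V : Type*} [AddCommGroup V] [Module ℂ V]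
    [FiniteDimensional ℂ V] {ρ : Rep p q r s V} (hρ : ρ.IsIrreducible)
    {a h : Submodule ℂ (Mat p q r s)} (hah : a ≤ h) {P : Set (Module.Dual ℂ h)}
    {lam : Module.Dual ℂ h} (ha : IsEvenCartanSubspace a) (hh : IsCartan h)
    (hθ : ∀ x ∈ h, theta x ∈ h) (hP : IsPositiveSystem (roots h) P) (hc : IsCompatible hah P)
    (hlam : ρ.HasHighestWeight h P lam)
    (hk : ∀ u : h, (u : Mat p q r s) ∈ kPart p q r s → lam u = 0) : ρ.IsSelfDual := by
  obtain ⟨g, hg, hhg⟩ := hh.exists_eq_conj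
  obtain ⟨π, t, hA⟩ := exists_isAdapted_of_theta_stable hg (hhg ▸ hθ)
  obtain ⟨d, hd, hdP⟩ := hP.exists_order hg hhg
  obtain ⟨v₀, hv₀, hw, hr⟩ := hlam
  obtain ⟨c, ε, hv, hε⟩ := ρ.exists_parity_eigenvector hv₀
  have hm := fun i => conjMap_matUnit_mem hhg i
  have hH : (ρ.conj g hA.even).IsHighest d (fun i => lam ⟨_, hm i⟩) ε
      (v₀ + c • ρ.parityOp v₀) :=
    { ne_zero := hv
      parityOp_eq := hε
      weight := fun i => by
        have h1 := ρ.parityOp_act (conjMap_mem hg (matUnit_self_mem i)) v₀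
        have h2 := hw ⟨_, hm i⟩
        simp only at h2
        rw [h2, map_smul] at h1
        simp only [sgn, ZMod.val_zero, mul_zero, pow_zero, one_smul] at h1
        rw [conj_act, map_add, map_smul, h2, ← h1, smul_add, smul_comm]
      raise := fun i j hij => by
        have h1 := ρ.parityOp_act (conjMap_mem hg (matUnit_mem i j)) v₀
        have h2 := hr _ (hdP i j hij) _ (conjMap_matUnit_mem_rootSpace hg hhg i j)
        rw [h2, map_zero] at h1
        have h3 := (smul_eq_zero.1 h1.symm).resolve_left (sgn_self_ne_zero _)
        rw [conj_act, map_add, map_smul, h2, h3, smul_zero, add_zero] }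
  refine isSelfDual_of_isAdapted hρ hA hd ?_ ?_ hH
  · intro i j hij hlt
    have hne : i ≠ j := by
      rintro rfl
      exact lt_irrefl _ hlt
    -- Such a `u` gives an element of `𝔥 ∩ 𝔭`, hence of `𝔞`, on which the root does not vanish; so
    -- its restriction is a restricted root.
    have hu : ∃ u : Idx p q r s → ℂ, (∀ k, u (π k) = -u k) ∧ u i ≠ u j := by
      rcases hij with hi | hj
      · obtain ⟨u, hu, hu'⟩ := exists_anti_invariant hA.invol hi
        exact ⟨u, hu, hu' j hne.symm⟩
      · obtain ⟨u, hu, hu'⟩ := exists_anti_invariant hA.invol hj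
        exact ⟨u, hu, (hu' i hne).symm⟩
    obtain ⟨u, hu, huij⟩ := hu
    have hua : conjMap g (Matrix.diagonal u) ∈ a := by
      refine ha.mem_of_mem_pPart hg hhg hah (hhg ▸ ⟨_, ⟨u, rfl⟩, rfl⟩) ?_
      rw [mem_pPart, theta_conjMap_diagonal hA, ← map_neg, Matrix.diagonal_neg]
      congr 2
      funext k
      exact hu k
    have h0 : restrict hah (entryForm h g i - entryForm h g j) ≠ 0 := by
      intro h0
      have := LinearMap.congr_fun h0 ⟨_, hua⟩
      change entryForm h g i ⟨_, hah hua⟩ - entryForm h g j ⟨_, hah hua⟩ = 0 at this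
      rw [entryForm_apply i _ rfl, entryForm_apply j _ rfl] at this
      exact huij (sub_eq_zero.1 this)
    have hneg : restrict hah (entryForm h g (π i) - entryForm h g (π j)) =
        -restrict hah (entryForm h g i - entryForm h g j) := by
      ext ⟨x, hx⟩
      obtain ⟨_, ⟨w, rfl⟩, hw⟩ := hhg ▸ hah hx
      change conjMap g (Matrix.diagonal w) = x at hw
      have hwπ : ∀ k, w (π k) = -w k := fun k => by
        have h1 := mem_pPart.1 (ha.1 hx)
        rw [← hw, theta_conjMap_diagonal hA, ← map_neg, Matrix.diagonal_neg] at h1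
        exact congrFun (Matrix.diagonal_injective (conjMap_injective g h1)) k
      change entryForm h g (π i) ⟨x, hah hx⟩ - entryForm h g (π j) ⟨x, hah hx⟩ =
        -(entryForm h g i ⟨x, hah hx⟩ - entryForm h g j ⟨x, hah hx⟩)
      rw [entryForm_apply _ _ hw, entryForm_apply _ _ hw, entryForm_apply _ _ hw,
        entryForm_apply _ _ hw, hwπ, hwπ]
      ring
    -- If `π` preserved the order of this pair, a restricted root and its negative would both be
    -- restrictions of positive roots, contradicting compatibility.
    rcases lt_trichotomy (d (π i)) (d (π j)) with h1 | h1 | h1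
    · exact h1
    · exact absurd (hA.invol.injective (hd h1)) hne
    · refine absurd ?_ (hc.2.1 _ ⟨⟨_, hdP i j hlt, rfl⟩, h0⟩)
      rw [← hneg]
      refine ⟨⟨_, hdP _ _ h1, rfl⟩, ?_⟩
      rw [hneg]
      exact neg_ne_zero.2 h0
  · intro i
    have := hk (⟨_, hm i⟩ + ⟨_, hm (π i)⟩) (by
      have := hA.conjMap_add_mem_kPart i
      rwa [map_add] at this)
    rwa [map_add] at this

end SuperGL

theorem mainTheorem3 (p q r s : ℕ) (hpqrs : 0 ≤ ((p : ℤ) - (q : ℤ)) * ((r : ℤ) - (s : ℤ))) :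
    SuperGL.IsEvenType p q r s ∧
    ∀ (V : Type*) [AddCommGroup V] [Module ℂ V] [FiniteDimensional ℂ V]
      (ρ : SuperGL.Rep p q r s V), ρ.IsIrreducible →
      (∀ (a h : Submodule ℂ (SuperGL.Mat p q r s)) (hah : a ≤ h)
        (P : Set (Module.Dual ℂ h)) (lam : Module.Dual ℂ h),
        SuperGL.IsEvenCartanSubspace a →
        SuperGL.IsCartan h →
        (∀ x ∈ h, SuperGL.theta x ∈ h) →
        SuperGL.IsPositiveSystem (SuperGL.roots h) P →
        SuperGL.IsCompatible hah P →
        ρ.HasHighestWeight h P lam →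
        (∀ u : h, (u : SuperGL.Mat p q r s) ∈ SuperGL.kPart p q r s → lam u = 0) →
        ρ.IsSelfDual) ∧
      (ρ.IsSpherical → ρ.IsSelfDual) := by
  exact ⟨SuperGL.isEvenType hpqrs, fun V _ _ _ ρ hρ =>
    ⟨fun _ _ hah _ _ ha hh hθ hP hc hlam hk =>
      SuperGL.Rep.HasHighestWeight.isSelfDual hρ hah ha hh hθ hP hc hlam hk,
      SuperGL.Rep.IsSpherical.isSelfDual hpqrs hρ⟩⟩
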